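/- **Théorème 4 (Appendice).** Let $n\ge 2$, $k_0\ge 2$, put $c(n,h)=\frac{(n-1+h)!}{(n-1)!\,h!}$, and let $d=c(n,k_0)$ (a *calibrated* number of foliations). Let $M$ be an $n$-dimensional complex manifold with a holomorphic $d$-web of codimension one, i.e. locally $d$ pairwise transverse foliations, defined by holomorphic submersions $u_1,\dots,u_d$. Let $U\subset M$ be an open set on which the web is *ordinary*: at each $m\in U$ and for each $h\ge 1$, the $d\times c(n,h)$ matrix of the monomials of degree $h$ evaluated at $du_1(m),\dots,du_d(m)$ has the maximal rank $\min(d,c(n,h))$. Let $R_k$ be the bundle of formal abelian relations of order $k$: its fibre at $m$ consists of the $k$-jets at $m$ of families $(\eta_i=f_i\,du_i)_{1\le i\le d}$ of holomorphic 1-forms such that $\sum_i\eta_i$ vanishes at $m$ up to order $k$ and every $d\eta_i$ vanishes at $m$ up to order $k-1$. Put $\mathcal E=R_{k_0-2}$, $F_0(\mathcal E)=\mathcal E$, and $F_h(\mathcal E)=\ker(R_{k_0-2}\to R_{h-1})$ for $1\le h\le k_0-1$. In local coordinates, a section $s$ of $\mathcal E$ is a family $(s_L)_{|L|\le k_0-2}$,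 where $s_L$ stands for the derivative $\partial^L$ of $(f_i)_i$. A holomorphic trivialization $(\sigma_a)$, $1\le a\le N:=\sum_{h=1}^{k_0-1}(d-c(n,h))$, of $\mathcal E$ over $U$ is *adapted* if, for $1\le h\le k_0-2$, the sections $\sigma_a$ with $\sum_{k=1}^{h}(d-c(n,k))<a\le\sum_{k=1}^{h+1}(d-c(n,k))$ span a complement of $F_{h+1}(\mathcal E)$ in $F_h(\mathcal E)$. Let $(\sigma_a)$ be adapted. Then, in any chart of $M$ on which the web is given by first integrals $u_1,\dots,u_d$, over the part of $U$ covered by the chart: 1. The projection $R_{k_0-1}\to R_{k_0-2}$ is bijective on each fibre, so that, $\hat s$ denoting the section of $R_{k_0-1}$ over a section $s$ of $\mathcal E$, the tautological connection $(\nabla_p s)_L=\partial_p s_L-\hat s_{L+1_p}$ $(|L|\le k_0-2)$ is defined. Relative to $(\sigma_a)$ it has a unique matrix $\theta=\sum_p\theta_p\,dy_p$, $\nabla_p\sigma_a=\sum_b(\theta_p)_{ba}\,\sigma_b$, and $\theta$ is holomorphic. 2. The curvature matrix $\Omega=d\theta+\theta\wedge\theta$ is concentrated in its last $\frac{(n-2+k_0)!}{(n-2)!\,k_0!}$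 rows: all entries $\Omega_{ba}$ of the preceding rows $b$ are zero. In particular, if $n=2$, only the last row can be nonzero. -/

import Mathlib

open scoped Manifold ContDiff Topology

noncomputable section

namespace OrdinaryWeb

/-- The number `(n-1+h)! / ((n-1)! h!)` of monomials of degree `h` in `n` variables. -/
def c (n h : ℕ) : ℕ := (n - 1 + h).factorial / ((n - 1).factorial * h.factorial)

/-! ### Partial derivatives and jets in coordinates -/

/-- The total order `|L|` of a multi-index. -/
def ord {n : ℕ} (L : Fin n → ℕ) : ℕ := ∑ p, L p

/-- The multi-index `L + 1_p`. -/
def incr {n : ℕ} (p : Fin n) (L : Fin n → ℕ) : Fin n → ℕ := L + Pi.single p 1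

/-- The partial derivative `∂_p g`. -/
def pderiv {n : ℕ} (p : Fin n) (g : (Fin n → ℂ) → ℂ) : (Fin n → ℂ) → ℂ :=
  fun y => fderiv ℂ g y (Pi.single p 1)

/-- The iterated partial derivative `∂^L g = ∂_1^{L_1} ⋯ ∂_n^{L_n} g`. -/
def mderiv {n : ℕ} (L : Fin n → ℕ) (g : (Fin n → ℂ) → ℂ) : (Fin n → ℂ) → ℂ :=
  (List.finRange n).foldr (fun p h => (pderiv p)^[L p] h) g

/-- Coordinates of jets of `d`-tuples of functions of `n` variables: the entry `x i L` stands for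
`∂^L f_i` at the base point.  A jet of order `k` has zero entries for `|L| > k`. -/
abbrev Jet (n d : ℕ) : Type := Fin d → (Fin n → ℕ) → ℂ

/-- Projection onto the jets of order `k`. -/
def trunc {n d : ℕ} (k : ℕ) (x : Jet n d) : Jet n d :=
  fun i L => if ord L ≤ k then x i L else 0

/-- The jet of order `k` at `y` of the `d`-tuple `f`. -/
def jetAt {n d : ℕ} (k : ℕ) (f : Fin d → (Fin n → ℂ) → ℂ) (y : Fin n → ℂ) : Jet n d :=
  trunc k fun i L => mderiv L (f i) y

/-- The value of `∂^L (f g)` at `y`, by the Leibniz rule, when `∂^K f (y) = w K` for all `K`. -/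
def leibniz {n : ℕ} (L : Fin n → ℕ) (w : (Fin n → ℕ) → ℂ) (g : (Fin n → ℂ) → ℂ)
    (y : Fin n → ℂ) : ℂ :=
  ∑ K ∈ Finset.Icc 0 L, ((∏ p, (L p).choose (K p) : ℕ) : ℂ) * w K * mderiv (L - K) g y

/-- The fibre at `y` of the bundle `R_k` of formal abelian relations of order `k`, for the foliations
with first integrals `v_1, …, v_d`: the jets of order `k` at `y` of the families of one-forms
`η_i = f_i dv_i` such that the trace `∑ η_i` vanishes at `y` up to order `k`, and every
`dη_i = df_i ∧ dv_i` vanishes at `y` up to order `k - 1`. -/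
def R {n d : ℕ} (v : Fin d → (Fin n → ℂ) → ℂ) (k : ℕ) (y : Fin n → ℂ) :
    Submodule ℂ (Jet n d) where
  carrier := {x |
    (∀ i L, k < ord L → x i L = 0) ∧
    (∀ p L, ord L ≤ k → ∑ i, leibniz L (x i) (pderiv p (v i)) y = 0) ∧
    (∀ i p q L, ord L < k →
      leibniz L (fun K => x i (incr p K)) (pderiv q (v i)) y
        - leibniz L (fun K => x i (incr q K)) (pderiv p (v i)) y = 0)}
  zero_mem' := by
    refine ⟨fun _ _ _ => rfl, ?_, ?_⟩ <;> intros <;> simp [leibniz]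
  add_mem' := by
    rintro x x' ⟨h1, h2, h3⟩ ⟨h1', h2', h3'⟩
    have add (L : Fin n → ℕ) (w w' : (Fin n → ℕ) → ℂ) (g : (Fin n → ℂ) → ℂ) :
        leibniz L (fun K => w K + w' K) g y = leibniz L w g y + leibniz L w' g y := by
      simp only [leibniz, ← Finset.sum_add_distrib]
      exact Finset.sum_congr rfl fun _ _ => by ring
    refine ⟨fun i L hL => by simp [h1 i L hL, h1' i L hL], fun p L hL => ?_, fun i p q L hL => ?_⟩
    · have e : ∀ i, leibniz L ((x + x') i) (pderiv p (v i)) y = _ := fun i =>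
        add L (x i) (x' i) (pderiv p (v i))
      simp only [e, Finset.sum_add_distrib, h2 p L hL, h2' p L hL, add_zero]
    · simp only [Pi.add_apply, add]
      linear_combination h3 i p q L hL + h3' i p q L hL
  smul_mem' := by
    rintro a x ⟨h1, h2, h3⟩
    have smul (L : Fin n → ℕ) (w : (Fin n → ℕ) → ℂ) (g : (Fin n → ℂ) → ℂ) :
        leibniz L (fun K => a * w K) g y = a * leibniz L w g y := by
      simp only [leibniz, Finset.mul_sum]
      exact Finset.sum_congr rfl fun _ _ => by ring
    refine ⟨fun i L hL => by simp [h1 i L hL], fun p L hL => ?_, fun i p q L hL => ?_⟩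
    · have e : ∀ i, leibniz L ((a • x) i) (pderiv p (v i)) y = _ := fun i =>
        smul L (x i) (pderiv p (v i))
      simp only [e, ← Finset.mul_sum, h2 p L hL, mul_zero]
    · simp only [Pi.smul_apply, smul_eq_mul, smul]
      linear_combination a * h3 i p q L hL

/-- The jets that vanish up to order `h - 1` (all jets if `h = 0`). -/
def vanishing (n d h : ℕ) : Submodule ℂ (Jet n d) where
  carrier := {x | ∀ i L, ord L < h → x i L = 0}
  zero_mem' := fun _ _ _ => rfl
  add_mem' := fun hx hx' i L hL => by simp [hx i L hL, hx' i L hL]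
  smul_mem' := fun a x hx i L hL => by simp [hx i L hL]

/-- The fibre at `y` of the filtration `F_h` of `R_k`: `F_0 = R_k`, and `F_h` is the kernel of the
projection `R_k → R_{h-1}` for `1 ≤ h ≤ k + 1`. -/
def filt {n d : ℕ} (v : Fin d → (Fin n → ℂ) → ℂ) (k h : ℕ) (y : Fin n → ℂ) :
    Submodule ℂ (Jet n d) :=
  R v k y ⊓ vanishing n d h

/-- `x'` is a formal abelian relation of order `k + 1` that projects to the jet `x` of order `k`. -/
def IsLift {n d : ℕ} (v : Fin d → (Fin n → ℂ) → ℂ) (k : ℕ) (y : Fin n → ℂ)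
    (x x' : Jet n d) : Prop :=
  x' ∈ R v (k + 1) y ∧ trunc k x' = x

/-- The inverse of the projection `R_{k+1} → R_k`, where this projection is bijective. -/
def lift {n d : ℕ} (v : Fin d → (Fin n → ℂ) → ℂ) (k : ℕ) (y : Fin n → ℂ) (x : Jet n d) :
    Jet n d :=
  Classical.epsilon (IsLift v k y x)

/-- The tautological covariant derivative in the direction of the `p`-th coordinate of a section `s`
of `R_k`: `(∇_p s)_L = ∂_p s_L - ŝ_{L + 1_p}` for `|L| ≤ k`, where `ŝ` is the section of `R_{k+1}`
over `s` (so `ŝ_{L + 1_p} = s_{L + 1_p}` if `|L| < k`). -/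
def covDeriv {n d : ℕ} (v : Fin d → (Fin n → ℂ) → ℂ) (k : ℕ) (p : Fin n)
    (s : (Fin n → ℂ) → Jet n d) (y : Fin n → ℂ) : Jet n d :=
  trunc k fun i L => pderiv p (fun z => s z i L) y - lift v k y (s y) i (incr p L)

/-- `θ = ∑ θ_p dy_p` is the (holomorphic) matrix on `V` of the tautological connection relative to the
frame `σ`: `∇_p σ_a = ∑_b (θ_p)_{b a} σ_b`.  Rows are indexed by `b`, columns by `a`. -/
def IsConnectionMatrix {n d N : ℕ} (v : Fin d → (Fin n → ℂ) → ℂ) (k : ℕ) (V : Set (Fin n → ℂ))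
    (σ : Fin N → (Fin n → ℂ) → Jet n d)
    (θ : Fin n → (Fin n → ℂ) → Matrix (Fin N) (Fin N) ℂ) : Prop :=
  (∀ p b a, DifferentiableOn ℂ (fun y => θ p y b a) V) ∧
  ∀ y ∈ V, ∀ p a, covDeriv v k p (σ a) y = ∑ b, θ p y b a • σ b y

/-- The coefficient of `dy_p ∧ dy_q` (`p < q`) in the curvature matrix `dθ + θ ∧ θ`. -/
def curvature {n N : ℕ} (θ : Fin n → (Fin n → ℂ) → Matrix (Fin N) (Fin N) ℂ) (p q : Fin n)
    (y : Fin n → ℂ) : Matrix (Fin N) (Fin N) ℂ :=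
  Matrix.of (fun b a => pderiv p (fun z => θ q z b a) y - pderiv q (fun z => θ p z b a) y)
    + (θ p y * θ q y - θ q y * θ p y)

/-! ### Webs on complex manifolds -/

section Manifold

variable {n d : ℕ} {M : Type*} [TopologicalSpace M] [ChartedSpace (Fin n → ℂ) M]

/-- The differential at `m` of a function on a complex manifold. -/
def diff (u : M → ℂ) (m : M) : TangentSpace 𝓘(ℂ, Fin n → ℂ) m →L[ℂ] ℂ :=
  mfderiv 𝓘(ℂ, Fin n → ℂ) 𝓘(ℂ, ℂ) u m

/-- The hyperplane tangent at `m` to the level hypersurface of `u` (if `du ≠ 0`). -/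
def tangentLeaf (u : M → ℂ) (m : M) : Submodule ℂ (TangentSpace 𝓘(ℂ, Fin n → ℂ) m) :=
  LinearMap.ker (diff (n := n) u m).toLinearMap

/-- On `V`, the field `H` of sets of hyperplanes is that of the tangent spaces to the leaves of `d`
pairwise transverse foliations, defined by the holomorphic submersions `u_1, …, u_d`. -/
structure IsFirstIntegrals
    (H : (m : M) → Set (Submodule ℂ (TangentSpace 𝓘(ℂ, Fin n → ℂ) m)))
    (V : Set M) (u : Fin d → M → ℂ) : Prop where
  holomorphic : ∀ i, MDifferentiableOn 𝓘(ℂ, Fin n → ℂ) 𝓘(ℂ, ℂ) (u i) V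
  submersion : ∀ m ∈ V, ∀ i, diff (n := n) (u i) m ≠ 0
  transverse : ∀ m ∈ V, Function.Injective fun i => tangentLeaf (n := n) (u i) m
  tangent : ∀ m ∈ V, H m = Set.range fun i => tangentLeaf (n := n) (u i) m

variable (n d M) in
/-- A holomorphic `d`-web of codimension one on `M`: locally, the superposition of `d` pairwise
transverse holomorphic foliations of codimension one.  (Globally the foliations may be permuted.) -/
structure Web where
  hyperplanes : (m : M) → Set (Submodule ℂ (TangentSpace 𝓘(ℂ, Fin n → ℂ) m))
  locally_foliated : ∀ m, ∃ V : Set M, IsOpen V ∧ m ∈ V ∧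
    ∃ u : Fin d → M → ℂ, IsFirstIntegrals hyperplanes V u

/-- Local data for a web: a holomorphic chart of `M`, and first integrals of the foliations of the
web on the domain of the chart. -/
structure LocalData (W : Web n d M) where
  chart : OpenPartialHomeomorph M (Fin n → ℂ)
  chart_mem : chart ∈ IsManifold.maximalAtlas 𝓘(ℂ, Fin n → ℂ) ω M
  u : Fin d → M → ℂ
  isFirstIntegrals : IsFirstIntegrals W.hyperplanes chart.source u

namespace LocalData

variable {W : Web n d M}

/-- The first integrals in the coordinates of the chart. -/
def v (D : LocalData W) (i : Fin d) : (Fin n → ℂ) → ℂ := D.u i ∘ D.chart.symm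

/-- The part of `U` covered by the chart, in coordinates. -/
def region (D : LocalData W) (U : Set M) : Set (Fin n → ℂ) :=
  D.chart.target ∩ D.chart.symm ⁻¹' U

/-- The matrix with rows `((∂v_i)^L)_{|L| = h}`, the monomials of degree `h` evaluated at `dv_i`. -/
def monomialMatrix (D : LocalData W) (h : ℕ) (y : Fin n → ℂ) :
    Matrix (Fin d) {L : Fin n → ℕ // L ∈ Finset.piAntidiag Finset.univ h} ℂ :=
  Matrix.of fun i L => ∏ p, pderiv p (D.v i) y ^ L.1 p

/-- The coordinates `x` in `D` and `x'` in `D'` represent the same jet of order `k` at `m` of families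
of one-forms vanishing on the leaves of the respective foliations: some family near `m`, written
`f_i du_i` in `D` and `f'_j du'_j` in `D'`, has these coordinates. -/
def SameJet (D D' : LocalData W) (k : ℕ) (m : M) (x x' : Jet n d) : Prop :=
  ∃ (f f' : Fin d → (Fin n → ℂ) → ℂ) (π : Equiv.Perm (Fin d)),
    (∀ i, AnalyticAt ℂ (f i) (D.chart m)) ∧ (∀ i, AnalyticAt ℂ (f' i) (D'.chart m)) ∧
    (∀ᶠ z in 𝓝 m, ∀ i,
      tangentLeaf (n := n) (D.u i) z = tangentLeaf (n := n) (D'.u (π i)) z ∧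
      f i (D.chart z) • diff (n := n) (D.u i) z
        = f' (π i) (D'.chart z) • diff (n := n) (D'.u (π i)) z) ∧
    x = jetAt k f (D.chart m) ∧ x' = jetAt k f' (D'.chart m)

end LocalData

namespace Web

/-- The web is ordinary at `m`: for all `h ≥ 1` the values at the `d` conormal directions of the
monomials of degree `h` form a matrix of the greatest possible rank. -/
def OrdinaryAt (W : Web n d M) (m : M) : Prop :=
  ∀ D : LocalData W, m ∈ D.chart.source → ∀ h, 1 ≤ h →
    (D.monomialMatrix h (D.chart m)).rank = min d (c n h)

/-- A holomorphic section of `R_k` over `U`, given by its coordinates in all local data. -/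
structure IsSection (W : Web n d M) (k : ℕ) (U : Set M)
    (s : LocalData W → (Fin n → ℂ) → Jet n d) : Prop where
  mem : ∀ D, ∀ y ∈ D.region U, s D y ∈ R D.v k y
  holomorphic : ∀ D i L, DifferentiableOn ℂ (fun y => s D y i L) (D.region U)
  compatible : ∀ D D' : LocalData W, ∀ m ∈ U, m ∈ D.chart.source → m ∈ D'.chart.source →
    D.SameJet D' k m (s D (D.chart m)) (s D' (D'.chart m))

/-- A holomorphic trivialization of `R_k` over `U`: sections that form a basis of every fibre. -/
structure IsTrivialization (W : Web n d M) (k : ℕ) (U : Set M) {N : ℕ}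
    (σ : Fin N → LocalData W → (Fin n → ℂ) → Jet n d) : Prop where
  isSection : ∀ a, W.IsSection k U (σ a)
  linearIndependent : ∀ D, ∀ y ∈ D.region U, LinearIndependent ℂ fun a => σ a D y
  span_eq : ∀ D, ∀ y ∈ D.region U, Submodule.span ℂ (Set.range fun a => σ a D y) = R D.v k y

end Web

/-- The number `∑_{k=1}^{h} (d - c(n,k))`. -/
def partialRank (n d h : ℕ) : ℕ := ∑ k ∈ Finset.Icc 1 h, (d - c n k)

/-- A trivialization of `R_{k₀-2}` is adapted if, for `1 ≤ h ≤ k₀ - 2`, the sections `σ_a` with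
`partialRank h < a ≤ partialRank (h+1)` (numbered from `1`; from `0` in the code) span a complement
of `F_{h+1}` in `F_h`. -/
def IsAdapted {W : Web n d M} (k₀ : ℕ) (U : Set M) {N : ℕ}
    (σ : Fin N → LocalData W → (Fin n → ℂ) → Jet n d) : Prop :=
  ∀ D : LocalData W, ∀ y ∈ D.region U, ∀ h, 1 ≤ h → h ≤ k₀ - 2 →
    let S := Submodule.span ℂ ((fun a => σ a D y) ''
      {a | partialRank n d h ≤ (a : ℕ) ∧ (a : ℕ) < partialRank n d (h + 1)})
    S ⊔ filt D.v (k₀ - 2) (h + 1) y = filt D.v (k₀ - 2) h y ∧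
      S ⊓ filt D.v (k₀ - 2) (h + 1) y = ⊥

end Manifold

end OrdinaryWeb

end

/-! Put `k = k₀ - 2`. Near a point `y`, a jet of `f dv` that is closed up to order `k - 1` is the
jet of `G(v) dv` for a polynomial `G` (`exists_jet_eq_eval_comp`), hence of `d(Γ(v))`. A formal
abelian relation of order `k` is therefore a family of potentials such that the derivatives of `∑
Γ_i(v_i)` of orders `1, …, k + 1` vanish at `y`. To lift it to order `k + 1`, one adds `a_i (v_i -
v_i(y))^(k+2) / (k+2)!` to each potential. This leaves the derivatives of lower order alone and
changes those of order `k + 2` by `a_i` times the monomials of degree `k + 2` in `dv_i`. Cancelling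
them is a linear system in the `a_i`, square because the web is calibrated and invertible because it
is ordinary; hence the lift exists and is unique (`exists_isLift`, `eq_of_isLift`).

The lift solves a linear system with holomorphic coefficients, so Cramer's rule makes it
holomorphic. Differentiating the equations satisfied by a section and subtracting the equations of
its lift one order higher shows that the connection preserves `R_k` (`covDeriv_mem`). Its matrix in
the frame is again the solution of an injective holomorphic system.

In the entries of order less than `k`, the lift is the section itself, so the covariant derivative
can be applied twice; equality of mixed partials then shows that the curvature takes values in jets
vanishing up to order `k - 1` (`sum_curvature_smul_apply`). These form the last nonzero step of the
filtration, which the last `d - c(n, k₀ - 1)` sections of an adapted frame span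
(`coeff_eq_zero_of_mem_filt`). Pascal's rule evaluates this number (`c_sub_c`). -/

noncomputable section

namespace OrdinaryWeb

/-! ### Holomorphy of directional derivatives in several variables -/

section Calculus

/-- Cauchy's estimate for the Fréchet derivative of a holomorphic function of several variables. -/
theorem norm_fderiv_le_of_forall_norm_le {E : Type*} [NormedAddCommGroup E] [NormedSpace ℂ E]
    {g : E → ℂ} {z : E} {r C : ℝ} (hr : 0 < r)
    (hg : ∀ x ∈ Metric.closedBall z r, DifferentiableAt ℂ g x)
    (hC : ∀ x ∈ Metric.closedBall z r, ‖g x‖ ≤ C) : ‖fderiv ℂ g z‖ ≤ C / r := by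
  have hC0 : 0 ≤ C := (norm_nonneg _).trans (hC z (Metric.mem_closedBall_self hr.le))
  refine ContinuousLinearMap.opNorm_le_bound _ (by positivity) fun w => ?_
  rcases eq_or_ne w 0 with rfl | hw
  · simp
  have hw' : 0 < ‖w‖ := norm_pos_iff.2 hw
  -- The estimate is the one-variable one on the complex line through `z` in the direction `w`,
  -- where the disc of radius `r / ‖w‖` stays in the ball.
  have mem : ∀ t : ℂ, t ∈ Metric.closedBall (0 : ℂ) (r / ‖w‖) →
      z + t • w ∈ Metric.closedBall z r := by
    intro t ht
    rw [mem_closedBall_zero_iff, le_div_iff₀ hw'] at ht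
    simpa [norm_smul] using ht
  have hd : ∀ t ∈ Metric.closedBall (0 : ℂ) (r / ‖w‖),
      HasDerivAt (fun t : ℂ => g (z + t • w)) (fderiv ℂ g (z + t • w) w) t := by
    intro t ht
    have h1 : HasDerivAt (fun t : ℂ => z + t • w) w t := by
      simpa using ((hasDerivAt_id t).smul_const w).const_add z
    exact (hg _ (mem t ht)).hasFDerivAt.comp_hasDerivAt t h1
  have h0 := (hd 0 (Metric.mem_closedBall_self (by positivity))).deriv
  have := Complex.norm_deriv_le_of_forall_mem_sphere_norm_le (c := 0) (C := C)
    (f := fun t : ℂ => g (z + t • w)) (div_pos hr hw')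
    (DifferentiableOn.diffContOnCl (fun t ht => by
      rw [closure_ball _ (div_pos hr hw').ne'] at ht
      exact (hd t ht).differentiableAt.differentiableWithinAt))
    (fun t ht => hC _ (mem t (Metric.sphere_subset_closedBall ht)))
  rw [h0] at this
  simp only [zero_smul, add_zero] at this
  calc _ ≤ _ := this
    _ = C / r * ‖w‖ := by field_simp

/-- The one-variable Cauchy formula on a circle in the direction `e` expresses the derivative along
`e` as an integral of values of `g`. That integral can be differentiated in the base point under the
integral sign, Cauchy's estimate providing the domination. -/
theorem DifferentiableOn.fderiv_apply_of_isOpen {E : Type*} [NormedAddCommGroup E]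
    [NormedSpace ℂ E] [FiniteDimensional ℂ E] {g : E → ℂ} {V : Set E}
    (hV : IsOpen V) (hg : DifferentiableOn ℂ g V) (e : E) :
    DifferentiableOn ℂ (fun y => fderiv ℂ g y e) V := by
  intro y₀ hy₀
  apply DifferentiableAt.differentiableWithinAt
  borelize E
  have : ProperSpace E := FiniteDimensional.proper ℂ E
  rcases eq_or_ne e 0 with rfl | he
  · simp
  have he' : 0 < ‖e‖ := norm_pos_iff.2 he
  obtain ⟨ε, hε, hεV⟩ := Metric.isOpen_iff.1 hV y₀ hy₀
  -- Three nested radii are needed: base points in the ball of radius `r`, circle points in that of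
  -- radius `2r`, and Cauchy balls around the latter in that of radius `3r < ε`.
  set r : ℝ := ε / 4 with hr
  have hr0 : 0 < r := by positivity
  have hKV : Metric.closedBall y₀ (3 * r) ⊆ V :=
    (Metric.closedBall_subset_ball (by linarith)).trans hεV
  have hgd : ∀ x ∈ V, DifferentiableAt ℂ g x := fun x hx =>
    (hg x hx).differentiableAt (hV.mem_nhds hx)
  obtain ⟨C, hC⟩ := (isCompact_closedBall y₀ (3 * r)).exists_bound_of_continuousOn
    (hg.continuousOn.mono hKV)
  have hball : ∀ z ∈ Metric.closedBall y₀ (2 * r), Metric.closedBall z r ⊆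
      Metric.closedBall y₀ (3 * r) := fun z hz =>
    Metric.closedBall_subset_closedBall' (by rw [Metric.mem_closedBall] at hz; linarith)
  have hbound : ∀ z ∈ Metric.closedBall y₀ (2 * r), ‖fderiv ℂ g z‖ ≤ C / r := fun z hz =>
    norm_fderiv_le_of_forall_norm_le hr0 (fun x hx => hgd x (hKV (hball z hz hx)))
      (fun x hx => hC x (hball z hz hx))
  set ρ : ℝ := r / ‖e‖ with hρ
  have hρ0 : 0 < ρ := by positivity
  have mem : ∀ x ∈ Metric.ball y₀ r, ∀ t ∈ Metric.closedBall (0 : ℂ) ρ,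
      x + t • e ∈ Metric.closedBall y₀ (2 * r) := by
    intro x hx t ht
    rw [mem_closedBall_zero_iff, hρ, le_div_iff₀ he'] at ht
    rw [Metric.mem_ball, dist_eq_norm] at hx
    rw [Metric.mem_closedBall, dist_eq_norm]
    calc ‖x + t • e - y₀‖ = ‖(x - y₀) + t • e‖ := by congr 1; abel
      _ ≤ ‖x - y₀‖ + ‖t‖ * ‖e‖ := (norm_add_le _ _).trans (by rw [norm_smul])
      _ ≤ 2 * r := by linarith
  have hsub : Metric.closedBall y₀ (2 * r) ⊆ V :=
    (Metric.closedBall_subset_closedBall (by linarith)).trans hKV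
  have cauchy : ∀ x ∈ Metric.ball y₀ r, fderiv ℂ g x e =
      (2 * Real.pi * Complex.I)⁻¹ * ∮ t in C(0, ρ), (1 / (t - 0) ^ 2) • g (x + t • e) := by
    intro x hx
    have hd : ∀ t ∈ Metric.closedBall (0 : ℂ) ρ,
        HasDerivAt (fun t : ℂ => g (x + t • e)) (fderiv ℂ g (x + t • e) e) t := by
      intro t ht
      have h1 : HasDerivAt (fun t : ℂ => x + t • e) e t := by
        simpa using ((hasDerivAt_id t).smul_const e).const_add x
      exact (hgd _ (hsub (mem x hx t ht))).hasFDerivAt.comp_hasDerivAt t h1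
    have := Complex.differentiable_on_off_countable_deriv_eq_smul_circleIntegral
      (f := fun t : ℂ => g (x + t • e)) (c := 0) hρ0 Set.countable_empty
      (fun t ht => (hd t ht).continuousAt.continuousWithinAt)
      (fun t ht => (hd t (Metric.ball_subset_closedBall ht.1)).differentiableAt)
    rw [this, (hd 0 (Metric.mem_closedBall_self hρ0.le)).deriv, smul_eq_mul,
      inv_mul_cancel_left₀ Complex.two_pi_I_ne_zero]
    simp
  have hcirc : ∀ θ : ℝ, circleMap 0 ρ θ ∈ Metric.closedBall (0 : ℂ) ρ := fun θ =>
    circleMap_mem_closedBall 0 hρ0.le θ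
  set κ : ℝ → ℂ := fun θ => deriv (circleMap 0 ρ) θ * (1 / (circleMap 0 ρ θ - 0) ^ 2) with hκ
  have hcne : ∀ θ, circleMap (0 : ℂ) ρ θ ≠ 0 := fun θ => by simp [hρ0.ne']
  have hκc : Continuous κ := by
    simp only [hκ, deriv_circleMap, sub_zero]
    refine Continuous.mul (by fun_prop) (Continuous.div (by fun_prop) (by fun_prop) fun θ => ?_)
    exact pow_ne_zero 2 (hcne θ)
  have hFc : ∀ x ∈ Metric.ball y₀ r,
      Continuous fun θ : ℝ => κ θ * g (x + circleMap 0 ρ θ • e) := by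
    intro x hx
    refine hκc.mul (continuous_iff_continuousAt.2 fun θ => ?_)
    have h1 : ContinuousAt g (x + circleMap 0 ρ θ • e) :=
      (hgd _ (hsub (mem x hx _ (hcirc θ)))).continuousAt
    exact ContinuousAt.comp (f := fun θ : ℝ => x + circleMap 0 ρ θ • e) h1
      (Continuous.continuousAt (by fun_prop))
  have key := intervalIntegral.hasFDerivAt_integral_of_dominated_of_fderiv_le
    (μ := MeasureTheory.volume) (a := 0) (b := 2 * Real.pi) (x₀ := y₀)
    (F := fun x θ => κ θ * g (x + circleMap 0 ρ θ • e))
    (F' := fun x θ => κ θ • fderiv ℂ g (x + circleMap 0 ρ θ • e))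
    (bound := fun θ => ‖κ θ‖ * (C / r))
    (Metric.ball_mem_nhds y₀ hr0)
    (Filter.eventually_of_mem (Metric.ball_mem_nhds y₀ hr0) fun x hx =>
      (hFc x hx).aestronglyMeasurable)
    ((hFc y₀ (Metric.mem_ball_self hr0)).intervalIntegrable _ _)
    -- Continuity of `fderiv ℂ g` is not yet known; its measurability holds for any `g` and is
    -- enough here.
    (hκc.aestronglyMeasurable.smul
      ((measurable_fderiv ℂ g).comp
        (Continuous.measurable (by fun_prop))).stronglyMeasurable.aestronglyMeasurable)
    (Filter.Eventually.of_forall fun θ _ x hx => by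
      rw [norm_smul]
      exact mul_le_mul_of_nonneg_left (hbound _ (mem x hx _ (hcirc θ))) (norm_nonneg _))
    (((hκc.norm).mul continuous_const).intervalIntegrable _ _)
    (Filter.Eventually.of_forall fun θ _ x hx => by
      have h1 := (hgd _ (hsub (mem x hx _ (hcirc θ)))).hasFDerivAt
      have h2 : HasFDerivAt (fun x => g (x + circleMap 0 ρ θ • e))
          (fderiv ℂ g (x + circleMap 0 ρ θ • e)) x := by
        have h3 := h1.comp x ((hasFDerivAt_id x).add_const (circleMap 0 ρ θ • e))
        rw [ContinuousLinearMap.comp_id] at h3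
        exact h3
      exact h2.const_mul (κ θ))
  have key2 := (key.differentiableAt).const_mul (2 * Real.pi * Complex.I : ℂ)⁻¹
  refine key2.congr_of_eventuallyEq ?_
  filter_upwards [Metric.ball_mem_nhds y₀ hr0] with x hx
  rw [cauchy x hx, circleIntegral]
  congr 1
  refine intervalIntegral.integral_congr fun θ _ => ?_
  simp [hκ, mul_assoc]

end Calculus

/-! ### Iterated partial derivatives, multi-indices and the Leibniz rule -/

section PartialDerivatives

variable {n : ℕ} {V : Set (Fin n → ℂ)} {g g' : (Fin n → ℂ) → ℂ}

theorem differentiableOn_pderiv (hV : IsOpen V) (hg : DifferentiableOn ℂ g V) (p : Fin n) :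
    DifferentiableOn ℂ (pderiv p g) V :=
  DifferentiableOn.fderiv_apply_of_isOpen hV hg _

theorem pderiv_eqOn (hV : IsOpen V) (h : Set.EqOn g g' V) (p : Fin n) :
    Set.EqOn (pderiv p g) (pderiv p g') V := fun y hy => by
  have : g =ᶠ[𝓝 y] g' := Filter.eventually_of_mem (hV.mem_nhds hy) h
  simp only [pderiv, this.fderiv_eq]

theorem pderiv_comm (hV : IsOpen V) (hg : DifferentiableOn ℂ g V) (p q : Fin n) :
    Set.EqOn (pderiv p (pderiv q g)) (pderiv q (pderiv p g)) V := fun y hy => by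
  have hgd : ∀ x ∈ V, DifferentiableAt ℂ g x := fun x hx =>
    (hg x hx).differentiableAt (hV.mem_nhds hx)
  have h2 : DifferentiableAt ℂ (fderiv ℂ g) y := by
    -- Writing the derivative as a finite combination of coordinate functionals reduces its
    -- differentiability to that of the partial derivatives.
    have e : fderiv ℂ g = fun z => ∑ r, pderiv r g z •
        (ContinuousLinearMap.proj r : (Fin n → ℂ) →L[ℂ] ℂ) := by
      funext z
      ext w
      conv_lhs => rw [pi_eq_sum_univ' w]
      simp [pderiv, mul_comm]
    rw [e]
    exact DifferentiableAt.fun_sum fun r _ => ((differentiableOn_pderiv hV hg r y hy).differentiableAt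
      (hV.mem_nhds hy)).smul_const _
  have e : ∀ p q : Fin n, pderiv p (pderiv q g) y =
      fderiv ℂ (fderiv ℂ g) y (Pi.single p 1) (Pi.single q 1) := fun p q => by
    change fderiv ℂ (fun z => fderiv ℂ g z (Pi.single q 1)) y (Pi.single p 1) = _
    rw [fderiv_clm_apply h2 (differentiableAt_const _)]
    simp
  rw [e, e]
  exact second_derivative_symmetric_of_eventually
    (Filter.eventually_of_mem (hV.mem_nhds hy) fun x hx => (hgd x hx).hasFDerivAt)
    h2.hasFDerivAt _ _

theorem differentiableOn_iterate_pderiv (hV : IsOpen V) (hg : DifferentiableOn ℂ g V) (p : Fin n)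
    (m : ℕ) : DifferentiableOn ℂ ((pderiv p)^[m] g) V := by
  induction m with
  | zero => exact hg
  | succ m ih => rw [Function.iterate_succ_apply']; exact differentiableOn_pderiv hV ih p

theorem iterate_pderiv_eqOn (hV : IsOpen V) (h : Set.EqOn g g' V) (p : Fin n) (m : ℕ) :
    Set.EqOn ((pderiv p)^[m] g) ((pderiv p)^[m] g') V := by
  induction m with
  | zero => exact h
  | succ m ih => simp only [Function.iterate_succ_apply']; exact pderiv_eqOn hV ih p

theorem iterate_pderiv_comm (hV : IsOpen V) (hg : DifferentiableOn ℂ g V) (p q : Fin n) (m : ℕ) :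
    Set.EqOn ((pderiv q)^[m] (pderiv p g)) (pderiv p ((pderiv q)^[m] g)) V := by
  induction m with
  | zero => exact fun _ _ => rfl
  | succ m ih =>
    simp only [Function.iterate_succ_apply']
    exact (pderiv_eqOn hV ih q).trans
      (pderiv_comm hV (differentiableOn_iterate_pderiv hV hg q m) q p)

/-- The iterated partial derivative with respect to the variables in a list. -/
def listDeriv (l : List (Fin n)) (L : Fin n → ℕ) (g : (Fin n → ℂ) → ℂ) : (Fin n → ℂ) → ℂ :=
  l.foldr (fun p h => (pderiv p)^[L p] h) g

theorem listDeriv_cons (q : Fin n) (l : List (Fin n)) (L : Fin n → ℕ) (g : (Fin n → ℂ) → ℂ) :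
    listDeriv (q :: l) L g = (pderiv q)^[L q] (listDeriv l L g) := rfl

theorem differentiableOn_listDeriv (hV : IsOpen V) (hg : DifferentiableOn ℂ g V)
    (l : List (Fin n)) (L : Fin n → ℕ) : DifferentiableOn ℂ (listDeriv l L g) V := by
  induction l with
  | nil => exact hg
  | cons q l ih => exact differentiableOn_iterate_pderiv hV ih q _

theorem listDeriv_eqOn (hV : IsOpen V) (h : Set.EqOn g g' V) (l : List (Fin n)) (L : Fin n → ℕ) :
    Set.EqOn (listDeriv l L g) (listDeriv l L g') V := by
  induction l with
  | nil => exact h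
  | cons q l ih => exact iterate_pderiv_eqOn hV ih q _

theorem listDeriv_pderiv (hV : IsOpen V) (hg : DifferentiableOn ℂ g V) (l : List (Fin n))
    (L : Fin n → ℕ) (p : Fin n) :
    Set.EqOn (listDeriv l L (pderiv p g)) (pderiv p (listDeriv l L g)) V := by
  induction l with
  | nil => exact fun _ _ => rfl
  | cons q l ih =>
    simp only [listDeriv_cons]
    exact (iterate_pderiv_eqOn hV ih q _).trans
      (iterate_pderiv_comm hV (differentiableOn_listDeriv hV hg l L) p q _)

theorem incr_self (p : Fin n) (L : Fin n → ℕ) : incr p L p = L p + 1 := by simp [incr]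

theorem incr_of_ne {p q : Fin n} (h : q ≠ p) (L : Fin n → ℕ) : incr p L q = L q := by
  simp [incr, h]

theorem incr_comm (p q : Fin n) (L : Fin n → ℕ) : incr p (incr q L) = incr q (incr p L) := by
  simp only [incr]; abel

theorem ord_incr (p : Fin n) (L : Fin n → ℕ) : ord (incr p L) = ord L + 1 := by
  simp [ord, incr, Finset.sum_add_distrib]

theorem listDeriv_incr_of_notMem {l : List (Fin n)} {p : Fin n} (hp : p ∉ l) (L : Fin n → ℕ)
    (g : (Fin n → ℂ) → ℂ) : listDeriv l (incr p L) g = listDeriv l L g := by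
  induction l with
  | nil => rfl
  | cons q l ih =>
    rw [List.mem_cons, not_or] at hp
    rw [listDeriv_cons, listDeriv_cons, ih hp.2, incr_of_ne (Ne.symm hp.1)]

/-- Since `p` occurs exactly once in the list, raising its exponent inserts exactly one `∂_p`, which
then commutes outwards. -/
theorem listDeriv_incr (hV : IsOpen V) (hg : DifferentiableOn ℂ g V) {l : List (Fin n)}
    (hl : l.Nodup) {p : Fin n} (hp : p ∈ l) (L : Fin n → ℕ) :
    Set.EqOn (listDeriv l (incr p L) g) (pderiv p (listDeriv l L g)) V := by
  induction l with
  | nil => simp at hp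
  | cons q l ih =>
    rw [List.nodup_cons] at hl
    simp only [listDeriv_cons]
    by_cases h : p = q
    · subst h
      rw [listDeriv_incr_of_notMem hl.1, incr_self, Function.iterate_succ_apply']
      exact fun _ _ => rfl
    · have hp' : p ∈ l := (List.mem_cons.1 hp).resolve_left h
      rw [incr_of_ne (Ne.symm h)]
      exact (iterate_pderiv_eqOn hV (ih hl.2 hp') q _).trans
        (iterate_pderiv_comm hV (differentiableOn_listDeriv hV hg l L) p q _)

theorem mderiv_zero (g : (Fin n → ℂ) → ℂ) : mderiv 0 g = g := by
  have : ∀ l : List (Fin n), listDeriv l 0 g = g := fun l => by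
    induction l with
    | nil => rfl
    | cons q l ih => rw [listDeriv_cons, ih]; rfl
  exact this _

theorem differentiableOn_mderiv (hV : IsOpen V) (hg : DifferentiableOn ℂ g V) (L : Fin n → ℕ) :
    DifferentiableOn ℂ (mderiv L g) V :=
  differentiableOn_listDeriv hV hg _ L

theorem mderiv_eqOn (hV : IsOpen V) (h : Set.EqOn g g' V) (L : Fin n → ℕ) :
    Set.EqOn (mderiv L g) (mderiv L g') V :=
  listDeriv_eqOn hV h _ L

theorem mderiv_pderiv (hV : IsOpen V) (hg : DifferentiableOn ℂ g V) (L : Fin n → ℕ) (p : Fin n) :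
    Set.EqOn (mderiv L (pderiv p g)) (pderiv p (mderiv L g)) V :=
  listDeriv_pderiv hV hg _ L p

theorem mderiv_incr (hV : IsOpen V) (hg : DifferentiableOn ℂ g V) (L : Fin n → ℕ) (p : Fin n) :
    Set.EqOn (mderiv (incr p L) g) (pderiv p (mderiv L g)) V :=
  listDeriv_incr hV hg (List.nodup_finRange n) (List.mem_finRange p) L

theorem mderiv_incr' (hV : IsOpen V) (hg : DifferentiableOn ℂ g V) (L : Fin n → ℕ) (p : Fin n) :
    Set.EqOn (mderiv (incr p L) g) (mderiv L (pderiv p g)) V :=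
  (mderiv_incr hV hg L p).trans (mderiv_pderiv hV hg L p).symm

theorem ord_eq_zero {L : Fin n → ℕ} (h : ord L = 0) : L = 0 := by
  funext p; simpa using (Finset.sum_eq_zero_iff.1 h) p (Finset.mem_univ p)

theorem exists_eq_incr {L : Fin n → ℕ} (h : 0 < ord L) : ∃ p K, L = incr p K := by
  obtain ⟨p, -, hp⟩ := Finset.exists_ne_zero_of_sum_ne_zero h.ne'
  refine ⟨p, L - Pi.single p 1, (tsub_add_cancel_of_le ?_).symm⟩
  intro q
  by_cases hq : q = p
  · subst hq; simpa using Nat.one_le_iff_ne_zero.2 hp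
  · simp [hq]

/-- Induction on multi-indices. -/
theorem incr_induction {P : (Fin n → ℕ) → Prop} (h0 : P 0) (h : ∀ p L, P L → P (incr p L))
    (L : Fin n → ℕ) : P L := by
  induction hm : ord L generalizing L with
  | zero => rwa [ord_eq_zero hm]
  | succ m ih =>
    obtain ⟨p, K, rfl⟩ := exists_eq_incr (L := L) (by omega)
    rw [ord_incr] at hm
    exact h p K (ih K (by omega))

theorem pderiv_add (hg : DifferentiableOn ℂ g V) (hg' : DifferentiableOn ℂ g' V) (hV : IsOpen V)
    (p : Fin n) : Set.EqOn (pderiv p (fun y => g y + g' y)) (fun y => pderiv p g y + pderiv p g' y)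
      V := fun y hy => by
  simp only [pderiv]
  rw [fderiv_fun_add ((hg y hy).differentiableAt (hV.mem_nhds hy))
    ((hg' y hy).differentiableAt (hV.mem_nhds hy))]
  rfl

theorem pderiv_const_mul (hg : DifferentiableOn ℂ g V) (hV : IsOpen V) (a : ℂ)
    (p : Fin n) : Set.EqOn (pderiv p (fun y => a * g y)) (fun y => a * pderiv p g y)
      V := fun y hy => by
  simp only [pderiv]
  rw [fderiv_const_mul ((hg y hy).differentiableAt (hV.mem_nhds hy))]
  rfl

theorem pderiv_mul (hg : DifferentiableOn ℂ g V) (hg' : DifferentiableOn ℂ g' V) (hV : IsOpen V)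
    (p : Fin n) : Set.EqOn (pderiv p (fun y => g y * g' y))
      (fun y => pderiv p g y * g' y + g y * pderiv p g' y) V := fun y hy => by
  simp only [pderiv]
  rw [fderiv_fun_mul ((hg y hy).differentiableAt (hV.mem_nhds hy))
    ((hg' y hy).differentiableAt (hV.mem_nhds hy))]
  simp only [add_apply, smul_apply, smul_eq_mul]
  ring

theorem pderiv_sum {ι : Type*} (s : Finset ι) {f : ι → (Fin n → ℂ) → ℂ}
    (hf : ∀ i, DifferentiableOn ℂ (f i) V) (hV : IsOpen V) (p : Fin n) :
    Set.EqOn (pderiv p (fun y => ∑ i ∈ s, f i y)) (fun y => ∑ i ∈ s, pderiv p (f i) y) V :=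
  fun y hy => by
  simp only [pderiv]
  rw [fderiv_fun_sum fun i _ => (hf i y hy).differentiableAt (hV.mem_nhds hy)]
  simp

theorem mderiv_add (hV : IsOpen V) (hg : DifferentiableOn ℂ g V) (hg' : DifferentiableOn ℂ g' V)
    (L : Fin n → ℕ) :
    Set.EqOn (mderiv L (fun y => g y + g' y)) (fun y => mderiv L g y + mderiv L g' y) V := by
  induction L using incr_induction with
  | h0 => simp only [mderiv_zero]; exact fun _ _ => rfl
  | h p L ih =>
    intro y hy
    rw [mderiv_incr hV (hg.fun_add hg') L p hy, pderiv_eqOn hV ih p hy,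
      pderiv_add (differentiableOn_mderiv hV hg L) (differentiableOn_mderiv hV hg' L) hV p hy]
    simp only [mderiv_incr hV hg L p hy, mderiv_incr hV hg' L p hy]

theorem mderiv_const_mul (hV : IsOpen V) (hg : DifferentiableOn ℂ g V) (a : ℂ) (L : Fin n → ℕ) :
    Set.EqOn (mderiv L (fun y => a * g y)) (fun y => a * mderiv L g y) V := by
  induction L using incr_induction with
  | h0 => simp only [mderiv_zero]; exact fun _ _ => rfl
  | h p L ih =>
    intro y hy
    rw [mderiv_incr hV (hg.const_mul a) L p hy, pderiv_eqOn hV ih p hy,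
      pderiv_const_mul (differentiableOn_mderiv hV hg L) hV a p hy]
    simp only [mderiv_incr hV hg L p hy]

/-! ### The Leibniz rule -/

theorem leibniz_const_mul (L : Fin n → ℕ) (a : ℂ) (w : (Fin n → ℕ) → ℂ) (g : (Fin n → ℂ) → ℂ)
    (y : Fin n → ℂ) : leibniz L (fun K => a * w K) g y = a * leibniz L w g y := by
  simp only [leibniz, Finset.mul_sum]
  exact Finset.sum_congr rfl fun _ _ => by ring

theorem leibniz_sub (L : Fin n → ℕ) (w w' : (Fin n → ℕ) → ℂ) (g : (Fin n → ℂ) → ℂ)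
    (y : Fin n → ℂ) :
    leibniz L (fun K => w K - w' K) g y = leibniz L w g y - leibniz L w' g y := by
  simp only [leibniz, ← Finset.sum_sub_distrib]
  exact Finset.sum_congr rfl fun _ _ => by ring

theorem ord_mono {K L : Fin n → ℕ} (h : K ≤ L) : ord K ≤ ord L :=
  Finset.sum_le_sum fun p _ => h p

theorem eq_of_le_of_ord_eq {K L : Fin n → ℕ} (h : K ≤ L) (h' : ord L ≤ ord K) : K = L := by
  have := (Finset.sum_eq_sum_iff_of_le fun p (_ : p ∈ Finset.univ) => h p).1
    (le_antisymm (ord_mono h) h')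
  funext p; exact this p (Finset.mem_univ p)

theorem leibniz_congr {L : Fin n → ℕ} {w w' : (Fin n → ℕ) → ℂ}
    (h : ∀ K, ord K ≤ ord L → w K = w' K) (g : (Fin n → ℂ) → ℂ) (y : Fin n → ℂ) :
    leibniz L w g y = leibniz L w' g y :=
  Finset.sum_congr rfl fun K hK => by rw [h K (ord_mono (Finset.mem_Icc.1 hK).2)]

/-- Every `K ≤ L` other than `L` has smaller order. This turns the top-order part of the equations
of `R_k` into algebra in the values of `dv_i`. -/
theorem leibniz_of_vanishing {L : Fin n → ℕ} {w : (Fin n → ℕ) → ℂ}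
    (h : ∀ K, ord K < ord L → w K = 0) (g : (Fin n → ℂ) → ℂ) (y : Fin n → ℂ) :
    leibniz L w g y = w L * g y := by
  rw [leibniz, Finset.sum_eq_single L]
  · simp [mderiv_zero]
  · intro K hK hne
    have hK := (Finset.mem_Icc.1 hK).2
    rw [h K (lt_of_not_ge fun h' => hne (eq_of_le_of_ord_eq hK h'))]; simp
  · intro h; simp at h

theorem mderiv_sub_incr (hV : IsOpen V) (hg : DifferentiableOn ℂ g V) {K L : Fin n → ℕ}
    (h : K ≤ L) (p : Fin n) :
    Set.EqOn (mderiv (incr p L - K) g) (mderiv (L - K) (pderiv p g)) V := by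
  have : incr p L - K = incr p (L - K) := by
    funext q; have : K q ≤ L q := h q
    simp only [incr, Pi.sub_apply, Pi.add_apply]; omega
  rw [this]; exact mderiv_incr' hV hg _ p

theorem prod_choose_incr_incr (p : Fin n) (L K : Fin n → ℕ) :
    ∏ q, (incr p L q).choose (incr p K q) =
      ∏ q, (L q).choose (K q) + ∏ q, (L q).choose (incr p K q) := by
  rw [← Finset.mul_prod_erase _ _ (Finset.mem_univ p), ← Finset.mul_prod_erase _ _ (Finset.mem_univ p),
    ← Finset.mul_prod_erase (a := p) _ (fun q => (L q).choose (incr p K q)) (Finset.mem_univ p)]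
  have h1 : ∏ q ∈ Finset.univ.erase p, (incr p L q).choose (incr p K q) =
      ∏ q ∈ Finset.univ.erase p, (L q).choose (K q) := Finset.prod_congr rfl fun q hq => by
    rw [incr_of_ne (Finset.ne_of_mem_erase hq), incr_of_ne (Finset.ne_of_mem_erase hq)]
  have h2 : ∏ q ∈ Finset.univ.erase p, (L q).choose (incr p K q) =
      ∏ q ∈ Finset.univ.erase p, (L q).choose (K q) := Finset.prod_congr rfl fun q hq => by
    rw [incr_of_ne (Finset.ne_of_mem_erase hq)]
  rw [h1, h2, incr_self, incr_self, Nat.choose_succ_succ]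
  ring

theorem prod_choose_incr_of_eq_zero {p : Fin n} (L : Fin n → ℕ) {K : Fin n → ℕ} (h : K p = 0) :
    ∏ q, (incr p L q).choose (K q) = ∏ q, (L q).choose (K q) :=
  Finset.prod_congr rfl fun q _ => by
    by_cases hq : q = p
    · subst hq; simp [h]
    · rw [incr_of_ne hq]

theorem prod_choose_eq_zero {L K : Fin n → ℕ} (h : ¬ K ≤ L) : ∏ q, (L q).choose (K q) = 0 := by
  simp only [Pi.le_def, not_forall, not_le] at h
  obtain ⟨q, hq⟩ := h
  exact Finset.prod_eq_zero (Finset.mem_univ q) (Nat.choose_eq_zero_of_lt hq)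

/-- Pascal's rule for multi-indices. -/
theorem sum_choose_incr (p : Fin n) (L : Fin n → ℕ) (F : (Fin n → ℕ) → ℂ) :
    ∑ K ∈ Finset.Icc 0 (incr p L), ((∏ q, (incr p L q).choose (K q) : ℕ) : ℂ) * F K =
      ∑ K ∈ Finset.Icc 0 L, ((∏ q, (L q).choose (K q) : ℕ) : ℂ) * F (incr p K) +
      ∑ K ∈ Finset.Icc 0 L, ((∏ q, (L q).choose (K q) : ℕ) : ℂ) * F K := by
  classical
  have hle : L ≤ incr p L := fun q => by simp [incr]
  have hinj : Function.Injective (incr p) := fun K K' h => by simpa [incr] using h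
  -- The indices with `K p ≠ 0` are exactly the shifts by `1_p`; Pascal's rule applies to these,
  -- while for `K p = 0` the coefficients for `L` and `L + 1_p` agree.
  have himg : (Finset.Icc 0 L).image (incr p) =
      (Finset.Icc 0 (incr p L)).filter fun K => K p ≠ 0 := by
    ext K
    simp only [Finset.mem_image, Finset.mem_filter, Finset.mem_Icc, zero_le, true_and]
    constructor
    · rintro ⟨K, hK, rfl⟩
      exact ⟨fun q => by simpa [incr] using hK q, by simp [incr]⟩
    · rintro ⟨hK, hp⟩
      refine ⟨K - Pi.single p 1, fun q => ?_, ?_⟩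
      · have := hK q
        by_cases hq : q = p
        · subst hq; simp [incr] at this ⊢; omega
        · simpa [incr, hq] using this
      · funext q
        by_cases hq : q = p
        · subst hq; simp [incr]; omega
        · simp [incr, hq]
  -- The range may be enlarged since the binomial coefficients vanish unless `K ≤ L`.
  have e1 : ∑ K ∈ Finset.Icc 0 L, ((∏ q, (L q).choose (K q) : ℕ) : ℂ) * F K =
      ∑ K ∈ Finset.Icc 0 (incr p L), ((∏ q, (L q).choose (K q) : ℕ) : ℂ) * F K := by
    refine Finset.sum_subset (Finset.Icc_subset_Icc le_rfl hle) fun K _ hK => ?_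
    rw [prod_choose_eq_zero fun h => hK (Finset.mem_Icc.2 ⟨zero_le, h⟩)]; simp
  rw [e1, ← Finset.sum_filter_add_sum_filter_not (Finset.Icc 0 (incr p L)) (fun K => K p ≠ 0),
    ← Finset.sum_filter_add_sum_filter_not (Finset.Icc 0 (incr p L)) (fun K => K p ≠ 0)
      (fun K => ((∏ q, (L q).choose (K q) : ℕ) : ℂ) * F K), ← himg,
    Finset.sum_image fun _ _ _ _ h => hinj h, Finset.sum_image fun _ _ _ _ h => hinj h, ← add_assoc,
    ← Finset.sum_add_distrib]
  congr 1
  · refine Finset.sum_congr rfl fun K _ => ?_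
    rw [prod_choose_incr_incr]; push_cast; ring
  · refine Finset.sum_congr rfl fun K hK => ?_
    have : K p = 0 := by simpa using (Finset.mem_filter.1 hK).2
    rw [prod_choose_incr_of_eq_zero L this]

theorem leibniz_incr (hV : IsOpen V) (hg : DifferentiableOn ℂ g V) {y : Fin n → ℂ} (hy : y ∈ V)
    (p : Fin n) (L : Fin n → ℕ) (w : (Fin n → ℕ) → ℂ) :
    leibniz (incr p L) w g y =
      leibniz L (fun K => w (incr p K)) g y + leibniz L w (pderiv p g) y := by
  simp only [leibniz, mul_assoc]
  rw [sum_choose_incr p L (fun K => w K * mderiv (incr p L - K) g y)]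
  congr 1
  · refine Finset.sum_congr rfl fun K _ => ?_
    have : incr p L - incr p K = L - K := by
      funext q; simp only [incr, Pi.sub_apply, Pi.add_apply]; omega
    rw [this]
  · refine Finset.sum_congr rfl fun K hK => ?_
    rw [mderiv_sub_incr hV hg (Finset.mem_Icc.1 hK).2 p hy]

theorem differentiableOn_leibniz (hV : IsOpen V) (hg : DifferentiableOn ℂ g V) (L : Fin n → ℕ)
    {w : (Fin n → ℂ) → (Fin n → ℕ) → ℂ} (hw : ∀ K, DifferentiableOn ℂ (fun y => w y K) V) :
    DifferentiableOn ℂ (fun y => leibniz L (w y) g y) V :=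
  DifferentiableOn.fun_sum fun K _ =>
    ((hw K).const_mul _).fun_mul (differentiableOn_mderiv hV hg _)

/-- Counterpart of `leibniz_incr`, in which `w` is a fixed formal jet: subtracting the two cancels
the `pderiv p g` terms and leaves the Leibniz expression of `∂_p w_K - w_{K + 1_p}`, the shape of
the tautological connection. -/
theorem pderiv_leibniz (hV : IsOpen V) (hg : DifferentiableOn ℂ g V) {y : Fin n → ℂ} (hy : y ∈ V)
    (p : Fin n) (L : Fin n → ℕ) {w : (Fin n → ℂ) → (Fin n → ℕ) → ℂ}
    (hw : ∀ K, DifferentiableOn ℂ (fun y => w y K) V) :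
    pderiv p (fun y => leibniz L (w y) g y) y =
      leibniz L (fun K => pderiv p (fun z => w z K) y) g y + leibniz L (w y) (pderiv p g) y := by
  simp only [leibniz]
  rw [pderiv_sum _ (fun K => ((hw K).const_mul _).fun_mul (differentiableOn_mderiv hV hg _)) hV p hy,
    ← Finset.sum_add_distrib]
  refine Finset.sum_congr rfl fun K _ => ?_
  rw [pderiv_mul ((hw K).const_mul _) (differentiableOn_mderiv hV hg _) hV p hy]
  simp only [pderiv_const_mul (hw K) hV _ p hy, mderiv_pderiv hV hg (L - K) p hy]

theorem mderiv_mul (hV : IsOpen V) (hg : DifferentiableOn ℂ g V) (hg' : DifferentiableOn ℂ g' V)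
    (L : Fin n → ℕ) :
    Set.EqOn (mderiv L (fun y => g y * g' y)) (fun y => leibniz L (fun K => mderiv K g y) g' y)
      V := by
  induction L using incr_induction with
  | h0 =>
    intro y _
    have := leibniz_of_vanishing (L := 0) (w := fun K => mderiv K g y)
      (fun K hK => by simp [ord] at hK) g' y
    simp only [this, mderiv_zero]
  | h p L ih =>
    intro y hy
    rw [mderiv_incr hV (hg.fun_mul hg') L p hy, pderiv_eqOn hV ih p hy,
      pderiv_leibniz hV hg' hy p L fun K => differentiableOn_mderiv hV hg K]
    simp only [leibniz_incr hV hg' hy, mderiv_incr hV hg _ p hy]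

end PartialDerivatives

/-! ### Formal abelian relations: potentials, principal parts and lifts -/

section FormalRelations

open Polynomial

variable {n d : ℕ} {V : Set (Fin n → ℂ)}

theorem prod_pow_incr (g : Fin n → ℂ) (p : Fin n) (L : Fin n → ℕ) :
    ∏ q, g q ^ incr p L q = (∏ q, g q ^ L q) * g p := by
  simp only [incr, Pi.add_apply, pow_add, Finset.prod_mul_distrib]
  congr 1
  rw [Finset.prod_eq_single p (fun q _ hq => by simp [hq]) (by simp)]
  simp

theorem differentiableOn_eval_comp {v : (Fin n → ℂ) → ℂ} (hv : DifferentiableOn ℂ v V) (G : ℂ[X]) :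
    DifferentiableOn ℂ (fun z => G.eval (v z)) V :=
  G.differentiable.comp_differentiableOn hv

theorem pderiv_eval_comp (hV : IsOpen V) {v : (Fin n → ℂ) → ℂ} (hv : DifferentiableOn ℂ v V)
    (G : ℂ[X]) (p : Fin n) :
    Set.EqOn (pderiv p fun z => G.eval (v z)) (fun z => (derivative G).eval (v z) * pderiv p v z)
      V := fun y hy => by
  have h := (G.hasDerivAt (v y)).comp_hasFDerivAt y
    ((hv y hy).differentiableAt (hV.mem_nhds hy)).hasFDerivAt
  have h' : HasFDerivAt (fun z => G.eval (v z)) _ y := h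
  simp only [pderiv, h'.fderiv]
  simp

/-- The one-forms `G(v) dv` are closed. -/
theorem leibniz_eval_comp_closed (hV : IsOpen V) {v : (Fin n → ℂ) → ℂ}
    (hv : DifferentiableOn ℂ v V) {y : Fin n → ℂ} (hy : y ∈ V) (G : ℂ[X]) (p q : Fin n)
    (L : Fin n → ℕ) :
    leibniz L (fun K => mderiv (incr p K) (fun z => G.eval (v z)) y) (pderiv q v) y =
      leibniz L (fun K => mderiv (incr q K) (fun z => G.eval (v z)) y) (pderiv p v) y := by
  have hG := differentiableOn_eval_comp hv G
  -- Both sides are `∂^L` of `G'(v) ∂_p v ∂_q v`, which is symmetric in `p` and `q`.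
  have key : ∀ p q : Fin n,
      leibniz L (fun K => mderiv (incr p K) (fun z => G.eval (v z)) y) (pderiv q v) y =
        mderiv L (fun z => (derivative G).eval (v z) * pderiv p v z * pderiv q v z) y := by
    intro p q
    have e := mderiv_mul hV (differentiableOn_pderiv hV hG p) (differentiableOn_pderiv hV hv q) L hy
    simp only [← mderiv_incr' hV hG _ p hy] at e
    rw [← e]
    refine mderiv_eqOn hV (fun z hz => ?_) L hy
    simp only [pderiv_eval_comp hV hv G p hz]
  rw [key, key]
  refine mderiv_eqOn hV (fun z _ => ?_) L hy
  ring

/-- For the exact form `d(Γ(v))`, the trace equations become equations on the derivatives of the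
potential, one order higher. -/
theorem leibniz_derivative_comp (hV : IsOpen V) {v : (Fin n → ℂ) → ℂ}
    (hv : DifferentiableOn ℂ v V) {y : Fin n → ℂ} (hy : y ∈ V) (Γ : ℂ[X]) (p : Fin n)
    (L : Fin n → ℕ) :
    leibniz L (fun K => mderiv K (fun z => (derivative Γ).eval (v z)) y) (pderiv p v) y =
      mderiv (incr p L) (fun z => Γ.eval (v z)) y := by
  rw [mderiv_incr' hV (differentiableOn_eval_comp hv _) L p hy,
    mderiv_eqOn hV (pderiv_eval_comp hV hv Γ p) L hy,
    mderiv_mul hV (differentiableOn_eval_comp hv _) (differentiableOn_pderiv hV hv p) L hy]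

theorem leibniz_eq_zero {L : Fin n → ℕ} {w : (Fin n → ℕ) → ℂ} (h : ∀ K, ord K ≤ ord L → w K = 0)
    (g : (Fin n → ℂ) → ℂ) (y : Fin n → ℂ) : leibniz L w g y = 0 := by
  rw [leibniz_of_vanishing (fun K hK => h K hK.le), h L le_rfl, zero_mul]

/-- These powers are the corrections that alter a jet in its top order only, there by `m!` times the
monomials in `dv`. Differentiating once lowers both the order and the exponent, whence the
induction. -/
theorem mderiv_sub_pow (hV : IsOpen V) {v : (Fin n → ℂ) → ℂ} (hv : DifferentiableOn ℂ v V)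
    {y : Fin n → ℂ} (hy : y ∈ V) (L : Fin n → ℕ) (m : ℕ) :
    (ord L < m → mderiv L (fun z => (v z - v y) ^ m) y = 0) ∧
      (ord L = m → mderiv L (fun z => (v z - v y) ^ m) y =
        m.factorial * ∏ p, pderiv p v y ^ L p) := by
  induction hN : ord L using Nat.strong_induction_on generalizing L m with
  | _ N ih =>
  subst hN
  rcases Nat.eq_zero_or_pos (ord L) with h0 | h0
  · obtain rfl := ord_eq_zero h0
    rw [mderiv_zero, h0]
    exact ⟨fun h => by simp [h.ne'], fun h => by simp [← h]⟩
  obtain ⟨p, K, rfl⟩ := exists_eq_incr h0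
  rw [ord_incr] at ih ⊢
  cases m with
  | zero => exact ⟨fun h => by omega, fun h => by omega⟩
  | succ m =>
    have hd : ∀ m : ℕ, DifferentiableOn ℂ (fun z => (v z - v y) ^ m) V := fun m =>
      (hv.sub_const _).fun_pow m
    have hpd : Set.EqOn (pderiv p fun z => (v z - v y) ^ (m + 1))
        (fun z => ((m + 1 : ℕ) * (v z - v y) ^ m) * pderiv p v z) V := fun z hz => by
      have := pderiv_eval_comp hV hv ((X - C (v y)) ^ (m + 1)) p hz
      simpa [derivative_pow] using this
    have e : mderiv (incr p K) (fun z => (v z - v y) ^ (m + 1)) y =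
        leibniz K (fun J => ((m + 1 : ℕ) : ℂ) * mderiv J (fun z => (v z - v y) ^ m) y)
          (pderiv p v) y := by
      rw [mderiv_incr' hV (hd _) K p hy, mderiv_eqOn hV hpd K hy,
        mderiv_mul hV ((hd m).const_mul _) (differentiableOn_pderiv hV hv p) K hy]
      simp only [mderiv_const_mul hV (hd m) _ _ hy]
    rw [e, leibniz_const_mul]
    refine ⟨fun h => ?_, fun h => ?_⟩
    · rw [leibniz_eq_zero fun J hJ => (ih (ord J) (by omega) J m rfl).1 (by omega), mul_zero]
    · rw [leibniz_of_vanishing fun J hJ => (ih (ord J) (by omega) J m rfl).1 (by omega),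
        (ih (ord K) (by omega) K m rfl).2 (by omega), prod_pow_incr, Nat.factorial_succ]
      push_cast; ring

/-- The principal part of a closed one-form `f dv` is a multiple of a power of `dv`. -/
theorem exists_eq_mul_prod_pow {g : Fin n → ℂ} {p₀ : Fin n} (hg : g p₀ ≠ 0) {k : ℕ}
    {z : (Fin n → ℕ) → ℂ}
    (h : ∀ p q K, ord K = k → z (incr p K) * g q = z (incr q K) * g p) :
    ∃ a, ∀ L, ord L = k + 1 → z L = a * ∏ p, g p ^ L p := by
  -- The symmetry trades the indices of `M` one at a time for `p₀`, each at the cost of a factor `g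
  -- p₀`, until only the pure entry in the direction `p₀` is left.
  have key : ∀ M : Fin n → ℕ, ∀ j, ord M + j = k + 1 →
      z (M + Pi.single p₀ j) * g p₀ ^ ord M = z (Pi.single p₀ (k + 1)) * ∏ p, g p ^ M p := by
    intro M
    induction M using incr_induction with
    | h0 => intro j hj; simp [ord] at hj; simp [ord, hj]
    | h p K ih =>
      intro j hj
      rw [ord_incr] at hj ⊢
      have ho : ord (K + Pi.single p₀ j) = k := by
        simp only [ord, Pi.add_apply, Finset.sum_add_distrib, Finset.sum_pi_single']
        simp only [ord] at hj; simp; omega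
      have e1 : incr p K + Pi.single p₀ j = incr p (K + Pi.single p₀ j) := by
        simp only [incr]; abel
      have e2 : incr p₀ (K + Pi.single p₀ j) = K + Pi.single p₀ (j + 1) := by
        simp only [incr, Pi.single_add]; abel
      have h1 := h p p₀ _ ho
      rw [e2] at h1
      rw [e1, prod_pow_incr]
      have h2 := ih (j + 1) (by omega)
      rw [pow_succ]
      linear_combination g p₀ ^ ord K * h1 + g p * h2
  refine ⟨z (Pi.single p₀ (k + 1)) / g p₀ ^ (k + 1), fun L hL => ?_⟩
  have := key L 0 (by omega)
  rw [hL] at this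
  simp only [Pi.single_zero, add_zero] at this
  rw [div_mul_eq_mul_div, eq_div_iff (pow_ne_zero _ hg), this]

theorem exists_derivative_eq (G : ℂ[X]) : ∃ Γ : ℂ[X], derivative Γ = G := by
  induction G using Polynomial.induction_on' with
  | add p q hp hq =>
    obtain ⟨P, rfl⟩ := hp
    obtain ⟨Q, rfl⟩ := hq
    exact ⟨P + Q, derivative_add⟩
  | monomial m a =>
    refine ⟨monomial (m + 1) (a / (m + 1)), ?_⟩
    rw [derivative_monomial]
    have : (m + 1 : ℂ) ≠ 0 := by exact_mod_cast Nat.succ_ne_zero m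
    simp [div_mul_cancel₀ _ this]

/-- A jet of order `k` of one-forms `f dv` that is closed up to order `k - 1` is the jet of a form
`G(v) dv`. -/
theorem exists_jet_eq_eval_comp (hV : IsOpen V) {v : (Fin n → ℂ) → ℂ}
    (hv : DifferentiableOn ℂ v V) {y : Fin n → ℂ} (hy : y ∈ V) (hne : ∃ p, pderiv p v y ≠ 0) (k : ℕ)
    (w : (Fin n → ℕ) → ℂ)
    (hw : ∀ p q L, ord L < k → leibniz L (fun K => w (incr p K)) (pderiv q v) y
      - leibniz L (fun K => w (incr q K)) (pderiv p v) y = 0) :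
    ∃ G : ℂ[X], ∀ L, ord L ≤ k → w L = mderiv L (fun z => G.eval (v z)) y := by
  induction k with
  | zero =>
    refine ⟨C (w 0), fun L hL => ?_⟩
    obtain rfl := ord_eq_zero (Nat.le_zero.1 hL)
    simp [mderiv_zero]
  | succ k ih =>
    obtain ⟨G, hG⟩ := ih fun p q L hL => hw p q L (by omega)
    obtain ⟨p₀, hp₀⟩ := hne
    have hGd := differentiableOn_eval_comp hv G
    -- The difference from `G(v)` vanishes up to order `k`, so closedness in order `k` constrains
    -- its principal part alone.
    obtain ⟨a, ha⟩ := exists_eq_mul_prod_pow (k := k) (g := fun p => pderiv p v y) hp₀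
      (z := fun L => w L - mderiv L (fun z => G.eval (v z)) y) (fun p q K hK => by
        have e : ∀ p q : Fin n, leibniz K (fun J => w (incr p J) -
            mderiv (incr p J) (fun z => G.eval (v z)) y) (pderiv q v) y =
            (w (incr p K) - mderiv (incr p K) (fun z => G.eval (v z)) y) * pderiv q v y :=
          fun p q => leibniz_of_vanishing (fun J hJ => sub_eq_zero.2 (hG _ (by
            rw [ord_incr]; omega))) _ _
        rw [← e, ← e, leibniz_sub, leibniz_sub]
        linear_combination hw p q K (by omega) - leibniz_eval_comp_closed hV hv hy G p q K)
    refine ⟨G + C (a / (k + 1).factorial) * (X - C (v y)) ^ (k + 1), fun L hL => ?_⟩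
    have hd : DifferentiableOn ℂ (fun z => (v z - v y) ^ (k + 1)) V := (hv.sub_const _).fun_pow _
    simp only [eval_add, eval_mul, eval_C, eval_pow, eval_sub, eval_X]
    rw [mderiv_add hV hGd (hd.const_mul _) L hy]
    simp only [mderiv_const_mul hV hd _ L hy]
    rcases Nat.lt_or_ge (ord L) (k + 1) with h | h
    · rw [(mderiv_sub_pow hV hv hy L (k + 1)).1 h, mul_zero, add_zero, hG L (by omega)]
    · have h' : ord L = k + 1 := le_antisymm hL h
      have hf : ((k + 1).factorial : ℂ) ≠ 0 := by exact_mod_cast Nat.factorial_ne_zero _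
      rw [(mderiv_sub_pow hV hv hy L (k + 1)).2 h', ← mul_assoc, div_mul_cancel₀ _ hf, ← ha L h']
      ring

/-- The jets of order `k + 1` that are formal abelian relations and vanish up to order `k` are zero
if the monomials of degree `k + 2` at the differentials of the first integrals are independent. -/
theorem eq_zero_of_principal_part {g : Fin d → Fin n → ℂ} {k : ℕ} (hne : ∀ i, ∃ p, g i p ≠ 0)
    (hinj : ∀ a : Fin d → ℂ, (∀ L : Fin n → ℕ, ord L = k + 2 →
      ∑ i, a i * ∏ p, g i p ^ L p = 0) → a = 0)
    {z : Jet n d} (htr : ∀ p L, ord L = k + 1 → ∑ i, z i L * g i p = 0)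
    (hcl : ∀ i p q K, ord K = k → z i (incr p K) * g i q - z i (incr q K) * g i p = 0)
    (i : Fin d) (L : Fin n → ℕ) (hL : ord L = k + 1) : z i L = 0 := by
  have : ∀ i, ∃ a, ∀ L, ord L = k + 1 → z i L = a * ∏ p, g i p ^ L p := fun i =>
    exists_eq_mul_prod_pow (hne i).choose_spec fun p q K hK => sub_eq_zero.1 (hcl i p q K hK)
  choose a ha using this
  rw [ha i L hL, hinj a, Pi.zero_apply, zero_mul]
  intro M hM
  -- The factor `g i p` in the trace raises the monomial of degree `k + 1` from the principal part
  -- to degree `k + 2`.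
  obtain ⟨p, K, rfl⟩ := exists_eq_incr (L := M) (by omega)
  rw [ord_incr] at hM
  rw [← htr p K (by omega)]
  refine Finset.sum_congr rfl fun j _ => ?_
  rw [ha j K (by omega), prod_pow_incr, mul_assoc]

variable {v : Fin d → (Fin n → ℂ) → ℂ} {y : Fin n → ℂ} {k : ℕ}

theorem mem_R_iff {x : Jet n d} : x ∈ R v k y ↔ (∀ i L, k < ord L → x i L = 0) ∧
    (∀ p L, ord L ≤ k → ∑ i, leibniz L (x i) (pderiv p (v i)) y = 0) ∧
    (∀ i p q L, ord L < k →
      leibniz L (fun K => x i (incr p K)) (pderiv q (v i)) y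
        - leibniz L (fun K => x i (incr q K)) (pderiv p (v i)) y = 0) := Iff.rfl

theorem trunc_of_le (x : Jet n d) (i : Fin d) {L : Fin n → ℕ} (h : ord L ≤ k) :
    trunc k x i L = x i L := if_pos h

theorem trunc_of_lt (x : Jet n d) (i : Fin d) {L : Fin n → ℕ} (h : k < ord L) :
    trunc k x i L = 0 := if_neg (not_le.2 h)

/-- The projection `R_{k+1} → R_k` is injective. -/
theorem eq_of_isLift (hne : ∀ i, ∃ p, pderiv p (v i) y ≠ 0)
    (hinj : ∀ a : Fin d → ℂ, (∀ L : Fin n → ℕ, ord L = k + 2 →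
      ∑ i, a i * ∏ p, pderiv p (v i) y ^ L p = 0) → a = 0)
    {x x' x'' : Jet n d} (h' : IsLift v k y x x') (h'' : IsLift v k y x x'') : x' = x'' := by
  have hz : x' - x'' ∈ R v (k + 1) y := Submodule.sub_mem _ h'.1 h''.1
  have low : ∀ i L, ord L ≤ k → (x' - x'') i L = 0 := fun i L hL => by
    have := congrFun (congrFun (h'.2.trans h''.2.symm) i) L
    rw [trunc_of_le _ _ hL, trunc_of_le _ _ hL] at this
    simp [this]
  obtain ⟨h1, h2, h3⟩ := mem_R_iff.1 hz
  rw [← sub_eq_zero]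
  funext i L
  rcases lt_trichotomy (ord L) (k + 1) with h | h | h
  · exact low i L (by omega)
  · refine eq_zero_of_principal_part (g := fun i p => pderiv p (v i) y) hne hinj
      (fun p K hK => ?_) (fun j p q K hK => ?_) i L h
    · rw [← h2 p K hK.le]
      exact Finset.sum_congr rfl fun j _ =>
        (leibniz_of_vanishing (fun J hJ => low j J (by omega)) _ _).symm
    · rw [← h3 j p q K (by omega),
        leibniz_of_vanishing (fun J hJ => low j _ (by rw [ord_incr]; omega)),
        leibniz_of_vanishing (fun J hJ => low j _ (by rw [ord_incr]; omega))]
  · exact h1 i L h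

/-- The projection `R_{k+1} → R_k` is surjective. -/
theorem exists_isLift (hV : IsOpen V) (hv : ∀ i, DifferentiableOn ℂ (v i) V) (hy : y ∈ V)
    (hne : ∀ i, ∃ p, pderiv p (v i) y ≠ 0)
    (hsurj : ∀ b : (Fin n → ℕ) → ℂ, ∃ a : Fin d → ℂ, ∀ L : Fin n → ℕ, ord L = k + 2 →
      ∑ i, a i * ∏ p, pderiv p (v i) y ^ L p = b L)
    {x : Jet n d} (hx : x ∈ R v k y) : ∃ x', IsLift v k y x x' := by
  obtain ⟨h1, h2, h3⟩ := mem_R_iff.1 hx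
  choose G hG using fun i => exists_jet_eq_eval_comp hV (hv i) hy (hne i) k (x i) (h3 i)
  choose Γ hΓ using fun i => exists_derivative_eq (G i)
  have hΓd := fun i => differentiableOn_eval_comp (hv i) (Γ i)
  -- The `a i` cancel the derivatives of order `k + 2` of the total potential, the only ones on
  -- which the lift imposes a new trace condition.
  obtain ⟨a, ha⟩ := hsurj fun L => - ∑ i, mderiv L (fun z => (Γ i).eval (v i z)) y
  have hf : ((k + 2).factorial : ℂ) ≠ 0 := by exact_mod_cast Nat.factorial_ne_zero _
  let Γ' : Fin d → ℂ[X] := fun i =>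
    Γ i + C (a i / (k + 2).factorial) * (X - C (v i y)) ^ (k + 2)
  have hΓ' : ∀ i L, mderiv L (fun z => (Γ' i).eval (v i z)) y =
      mderiv L (fun z => (Γ i).eval (v i z)) y + a i / (k + 2).factorial *
        mderiv L (fun z => (v i z - v i y) ^ (k + 2)) y := by
    intro i L
    have hd : DifferentiableOn ℂ (fun z => (v i z - v i y) ^ (k + 2)) V :=
      ((hv i).sub_const _).fun_pow _
    simp only [Γ', eval_add, eval_mul, eval_C, eval_pow, eval_sub, eval_X]
    rw [mderiv_add hV (hΓd i) (hd.const_mul _) L hy]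
    simp only [mderiv_const_mul hV hd _ L hy]
  let f : Fin d → (Fin n → ℂ) → ℂ := fun i z => (derivative (Γ' i)).eval (v i z)
  -- After differentiation the correction is a multiple of `(v i - v i y)^(k+1)`, which does not
  -- affect jets of order `k`.
  have hlow : ∀ i L, ord L ≤ k → mderiv L (f i) y = x i L := by
    intro i L hL
    have hd : DifferentiableOn ℂ (fun z => (v i z - v i y) ^ (k + 1)) V :=
      ((hv i).sub_const _).fun_pow _
    have e : f i = fun z => (G i).eval (v i z) +
        (a i / (k + 2).factorial * (k + 2 : ℕ)) * (v i z - v i y) ^ (k + 1) := by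
      funext z
      simp only [f, Γ', derivative_add, hΓ, derivative_C_mul, derivative_X_sub_C_pow, eval_add,
        eval_mul, eval_C, eval_pow, eval_sub, eval_X]
      rw [show k + 2 - 1 = k + 1 from rfl]
      push_cast; ring
    rw [e, mderiv_add hV (differentiableOn_eval_comp (hv i) _) (hd.const_mul _) L hy]
    simp only [mderiv_const_mul hV hd _ L hy]
    rw [(mderiv_sub_pow hV (hv i) hy L (k + 1)).1 (by omega), mul_zero, add_zero, hG i L hL]
  have hjet : ∀ i K, ord K ≤ k + 1 → jetAt (k + 1) f y i K = mderiv K (f i) y :=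
    fun i K hK => trunc_of_le _ i hK
  refine ⟨jetAt (k + 1) f y, mem_R_iff.2 ⟨fun i L hL => trunc_of_lt _ _ hL, fun p L hL => ?_,
    fun i p q L hL => ?_⟩, ?_⟩
  · have e : ∀ i, leibniz L (jetAt (k + 1) f y i) (pderiv p (v i)) y =
        mderiv (incr p L) (fun z => (Γ' i).eval (v i z)) y := fun i => by
      rw [leibniz_congr fun K hK => hjet i K (hK.trans hL)]
      exact leibniz_derivative_comp hV (hv i) hy _ p L
    rcases Nat.lt_or_ge (ord L) (k + 1) with h | h
    · rw [← h2 p L (by omega)]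
      exact Finset.sum_congr rfl fun i _ => leibniz_congr (fun K hK => by
        rw [hjet i K (by omega), hlow i K (by omega)]) _ _
    · have hL' : ord (incr p L) = k + 2 := by rw [ord_incr]; omega
      have e2 : ∀ i, mderiv (incr p L) (fun z => (Γ' i).eval (v i z)) y =
          mderiv (incr p L) (fun z => (Γ i).eval (v i z)) y +
            a i * ∏ q, pderiv q (v i) y ^ incr p L q := fun i => by
        rw [hΓ', (mderiv_sub_pow hV (hv i) hy _ (k + 2)).2 hL', ← mul_assoc, div_mul_cancel₀ _ hf]
      simp only [e, e2, Finset.sum_add_distrib, ha _ hL', add_neg_cancel]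
  · rw [sub_eq_zero, leibniz_congr fun K hK => hjet i (incr p K) (by rw [ord_incr]; omega),
      leibniz_congr (w := fun K => jetAt (k + 1) f y i (incr q K)) fun K hK =>
        hjet i (incr q K) (by rw [ord_incr]; omega)]
    exact leibniz_eval_comp_closed hV (hv i) hy _ p q L
  · funext i L
    rcases Nat.lt_or_ge k (ord L) with h | h
    · rw [trunc_of_lt _ _ h, h1 i L h]
    · rw [trunc_of_le _ _ h, hjet i L (by omega), hlow i L h]

end FormalRelations

/-! ### Holomorphic solutions of injective linear systems -/

section LinearSystems

theorem differentiableAt_det {E ι : Type*} [NormedAddCommGroup E] [NormedSpace ℂ E] [Fintype ι]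
    [DecidableEq ι] {A : E → Matrix ι ι ℂ} {y : E}
    (hA : ∀ i j, DifferentiableAt ℂ (fun y => A y i j) y) :
    DifferentiableAt ℂ (fun y => (A y).det) y := by
  simp only [Matrix.det_apply]
  exact DifferentiableAt.fun_sum fun s _ =>
    (HasFDerivAt.finsetProd fun i _ => (hA (s i) i).hasFDerivAt).differentiableAt.const_smul _

/-- The solution of an injective linear system with holomorphic coefficients and holomorphic
right-hand side is holomorphic. -/
theorem differentiableOn_of_injective_system {E ι κ : Type*} [NormedAddCommGroup E]
    [NormedSpace ℂ E] [Fintype ι] {V : Set E} (hV : IsOpen V)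
    (φ : κ → E → (ι → ℂ) →ₗ[ℂ] ℂ) (x : E → ι → ℂ)
    (hφ : ∀ k c, DifferentiableOn ℂ (fun y => φ k y c) V)
    (hx : ∀ k, DifferentiableOn ℂ (fun y => φ k y (x y)) V)
    (hinj : ∀ y ∈ V, ∀ c, (∀ k, φ k y c = 0) → c = 0) (i : ι) :
    DifferentiableOn ℂ (fun y => x y i) V := by
  classical
  intro y₀ hy₀
  apply DifferentiableAt.differentiableWithinAt
  have at' : ∀ {f : E → ℂ}, DifferentiableOn ℂ f V → DifferentiableAt ℂ f y₀ := fun h =>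
    (h y₀ hy₀).differentiableAt (hV.mem_nhds hy₀)
  have hspan : Submodule.span ℂ (Set.range fun k => φ k y₀) = ⊤ := by
    refine Submodule.eq_top_of_finrank_eq ?_
    have h0 : (Submodule.span ℂ (Set.range fun k => φ k y₀)).dualCoannihilator = ⊥ :=
      (Submodule.eq_bot_iff _).2 fun c hc => hinj y₀ hy₀ c fun k =>
        (Submodule.mem_dualCoannihilator c).1 hc _ (Submodule.subset_span ⟨k, rfl⟩)
    have h1 := Subspace.finrank_add_finrank_dualCoannihilator_eq
      (Submodule.span ℂ (Set.range fun k => φ k y₀))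
    rw [h0, finrank_bot, add_zero] at h1
    rw [h1, Subspace.dual_finrank_eq]
  -- The possibly infinite family of equations spans the dual at `y₀`, so a basis extracted from it
  -- gives a square system invertible at `y₀`, hence nearby, and Cramer's rule applies.
  obtain ⟨e, he⟩ : ∃ e : ι → κ, ∀ c, (∀ i, φ (e i) y₀ c = 0) → c = 0 := by
    obtain ⟨κ', a, -, hsp, hli⟩ := exists_linearIndependent' ℂ fun k => φ k y₀
    have b := Module.Basis.mk hli (by rw [hsp, hspan])
    have : Fintype κ' := @Fintype.ofFinite κ' (Module.Finite.finite_basis b)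
    have hcard : Fintype.card ι = Fintype.card κ' := by
      rw [← Module.finrank_eq_card_basis b, Subspace.dual_finrank_eq, Module.finrank_pi]
    let ε := Fintype.equivOfCardEq hcard
    refine ⟨a ∘ ε, fun c hc => hinj y₀ hy₀ c fun k => ?_⟩
    have hk : φ k y₀ ∈ Submodule.span ℂ (Set.range ((fun k => φ k y₀) ∘ a)) := by
      rw [hsp]; exact Submodule.subset_span ⟨k, rfl⟩
    have hle : Submodule.span ℂ (Set.range ((fun k => φ k y₀) ∘ a)) ≤
        LinearMap.ker (LinearMap.applyₗ (R := ℂ) (M₂ := ℂ) c) := by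
      rw [Submodule.span_le]
      rintro _ ⟨r, rfl⟩
      simpa using hc (ε.symm r)
    simpa using hle hk
  let A : E → Matrix ι ι ℂ := fun y => Matrix.of fun r j => φ (e r) y (Pi.single j 1)
  have hA : ∀ r j, DifferentiableOn ℂ (fun y => A y r j) V := fun r j => hφ _ _
  have hAx : ∀ y c, (A y).mulVec c = fun r => φ (e r) y c := fun y c => by
    funext r
    rw [LinearMap.pi_apply_eq_sum_univ (φ (e r) y) c]
    simp only [Matrix.mulVec, dotProduct, A, Matrix.of_apply, smul_eq_mul]
    refine Finset.sum_congr rfl fun j _ => ?_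
    rw [mul_comm]
    congr 2
    funext l
    simp [Pi.single_apply, eq_comm]
  have hdet : (A y₀).det ≠ 0 := fun h => by
    obtain ⟨c, hc, hc0⟩ := Matrix.exists_mulVec_eq_zero_iff.2 h
    rw [hAx] at hc0
    exact hc (he c (congrFun hc0))
  have hdetd : DifferentiableAt ℂ (fun y => (A y).det) y₀ :=
    differentiableAt_det fun r j => at' (hA r j)
  have hcr : DifferentiableAt ℂ (fun y => ((A y).updateCol i fun r => φ (e r) y (x y)).det) y₀ :=
    differentiableAt_det fun r j => by
      by_cases h : j = i
      · subst h; simpa using at' (hx (e r))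
      · simpa [h] using at' (hA r j)
  refine (hcr.fun_mul (hdetd.fun_inv hdet)).congr_of_eventuallyEq ?_
  filter_upwards [hdetd.continuousAt.eventually_ne hdet] with y hy
  rw [← div_eq_mul_inv, eq_div_iff hy, ← Matrix.cramer_apply, ← hAx, Matrix.cramer_eq_adjugate_mulVec,
    Matrix.mulVec_mulVec, Matrix.adjugate_mul]
  simp [Matrix.smul_mulVec, mul_comm]

end LinearSystems

/-! ### The tautological connection, its matrix and its curvature -/

section Connection

variable {n d k : ℕ} {V : Set (Fin n → ℂ)} {v : Fin d → (Fin n → ℂ) → ℂ}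

/-- The monomials of degree `h` at the differentials of the functions `v_i` form an invertible
square matrix. -/
structure MonomialsInvertible (v : Fin d → (Fin n → ℂ) → ℂ) (h : ℕ) (y : Fin n → ℂ) : Prop where
  injective : ∀ a : Fin d → ℂ, (∀ L : Fin n → ℕ, ord L = h →
    ∑ i, a i * ∏ p, pderiv p (v i) y ^ L p = 0) → a = 0
  surjective : ∀ b : (Fin n → ℕ) → ℂ, ∃ a : Fin d → ℂ, ∀ L : Fin n → ℕ, ord L = h →
    ∑ i, a i * ∏ p, pderiv p (v i) y ^ L p = b L

/-- If `dv_i` were zero, all its monomials of positive degree would vanish, and the `i`-th basis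
vector would contradict injectivity. -/
theorem MonomialsInvertible.exists_pderiv_ne_zero {h : ℕ} (hh : h ≠ 0) {y : Fin n → ℂ}
    (H : MonomialsInvertible v h y) (i : Fin d) : ∃ p, pderiv p (v i) y ≠ 0 := by
  by_contra! h0
  have := H.injective (Pi.single i 1) fun L hL => by
    obtain ⟨p, K, rfl⟩ := exists_eq_incr (L := L) (by omega)
    rw [Finset.sum_eq_single i (fun j _ hj => by simp [hj]) (by simp), prod_pow_incr, h0 p]
    simp
  simpa using congrFun this i

theorem existsUnique_isLift (hV : IsOpen V) (hv : ∀ i, DifferentiableOn ℂ (v i) V)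
    {y : Fin n → ℂ} (hy : y ∈ V) (H : MonomialsInvertible v (k + 2) y) {x : Jet n d}
    (hx : x ∈ R v k y) : ∃! x', IsLift v k y x x' :=
  existsUnique_of_exists_of_unique
    (exists_isLift hV hv hy (H.exists_pderiv_ne_zero (by omega)) H.surjective hx)
    fun _ _ h h' => eq_of_isLift (H.exists_pderiv_ne_zero (by omega)) H.injective h h'

theorem isLift_lift (hV : IsOpen V) (hv : ∀ i, DifferentiableOn ℂ (v i) V)
    {y : Fin n → ℂ} (hy : y ∈ V) (H : MonomialsInvertible v (k + 2) y) {x : Jet n d}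
    (hx : x ∈ R v k y) : IsLift v k y x (lift v k y x) :=
  Classical.epsilon_spec (existsUnique_isLift hV hv hy H hx).exists

theorem IsLift.apply_of_le {y : Fin n → ℂ} {x x' : Jet n d} (h : IsLift v k y x x') (i : Fin d)
    {L : Fin n → ℕ} (hL : ord L ≤ k) : x' i L = x i L := by
  rw [← h.2, trunc_of_le _ _ hL]

variable {s : (Fin n → ℂ) → Jet n d}

/-- The derivatives of order `k + 1` of the lift are determined by a linear system. -/
theorem differentiableOn_lift (hV : IsOpen V) (hv : ∀ i, DifferentiableOn ℂ (v i) V)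
    (H : ∀ y ∈ V, MonomialsInvertible v (k + 2) y) (hs : ∀ y ∈ V, s y ∈ R v k y)
    (hsd : ∀ i L, DifferentiableOn ℂ (fun y => s y i L) V) (i : Fin d) (L : Fin n → ℕ) :
    DifferentiableOn ℂ (fun y => lift v k y (s y) i L) V := by
  have hl : ∀ y ∈ V, IsLift v k y (s y) (lift v k y (s y)) := fun y hy =>
    isLift_lift hV hv hy (H y hy) (hs y hy)
  rcases Nat.lt_trichotomy (ord L) (k + 1) with h | h | h
  · exact (hsd i L).congr fun y hy => (hl y hy).apply_of_le i (by omega)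
  swap
  · exact (differentiableOn_const 0).congr fun y hy => (mem_R_iff.1 (hl y hy).1).1 i L h
  let I := {L : Fin n → ℕ // L ∈ Finset.piAntidiag Finset.univ (k + 1)}
  have : Fintype I := Finset.fintypeCoeSort _
  have hI : ∀ {L : Fin n → ℕ}, L ∈ Finset.piAntidiag Finset.univ (k + 1) ↔ ord L = k + 1 := by
    intro L; simp [ord]
  let pr : Fin d → (L : Fin n → ℕ) → ord L = k + 1 → (Fin d × I → ℂ) →ₗ[ℂ] ℂ := fun i L hL =>
    LinearMap.proj (i, ⟨L, hI.2 hL⟩)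
  have hinc : ∀ (p : Fin n) {K : Fin n → ℕ}, ord K = k → ord (incr p K) = k + 1 := fun p K hK => by
    rw [ord_incr, hK]
  -- The first family is the principal part of the trace equations in order `k + 1`, the second that
  -- of the closedness equations in order `k`.
  let φ : (Fin n × {L : Fin n → ℕ // ord L = k + 1}) ⊕
      (Fin d × Fin n × Fin n × {K : Fin n → ℕ // ord K = k}) →
      (Fin n → ℂ) → (Fin d × I → ℂ) →ₗ[ℂ] ℂ :=
    Sum.elim (fun e y => ∑ i, pderiv e.1 (v i) y • pr i e.2 e.2.2)
      (fun e y => pderiv e.2.2.1 (v e.1) y • pr e.1 (incr e.2.1 e.2.2.2) (hinc _ e.2.2.2.2) -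
        pderiv e.2.1 (v e.1) y • pr e.1 (incr e.2.2.1 e.2.2.2) (hinc _ e.2.2.2.2))
  have hpd : ∀ p i, DifferentiableOn ℂ (pderiv p (v i)) V := fun p i =>
    differentiableOn_pderiv hV (hv i) p
  -- the part of order `k + 1` of a jet contributes its principal part to the Leibniz rule
  have split : ∀ y ∈ V, ∀ (w w' : (Fin n → ℕ) → ℂ) (g : (Fin n → ℂ) → ℂ) (K : Fin n → ℕ),
      (∀ J, ord J < ord K → w J = w' J) →
      (w K - w' K) * g y = leibniz K w g y - leibniz K w' g y := by
    intro y _ w w' g K hJ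
    rw [← leibniz_sub, leibniz_of_vanishing fun J h => sub_eq_zero.2 (hJ J h)]
  have low : ∀ y ∈ V, ∀ i K, ord K ≤ k → lift v k y (s y) i K = s y i K := fun y hy i K hK =>
    (hl y hy).apply_of_le i hK
  -- As `s` is zero in order `k + 1`, comparing the lift with `s` isolates the unknown top entries
  -- and moves everything else to a holomorphic right-hand side.
  have top : ∀ y ∈ V, ∀ i K, ord K = k + 1 → s y i K = 0 := fun y hy i K hK =>
    (mem_R_iff.1 (hs y hy)).1 i K (by omega)
  refine differentiableOn_of_injective_system hV φ
    (fun y j => lift v k y (s y) j.1 j.2) ?_ ?_ ?_ (i, ⟨L, hI.2 h⟩)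
  · rintro (⟨p, L, hL⟩ | ⟨i, p, q, K, hK⟩) c
    · simp only [φ, Sum.elim_inl, LinearMap.sum_apply, LinearMap.smul_apply, smul_eq_mul]
      exact DifferentiableOn.fun_sum fun i _ => (hpd p i).mul_const _
    · simp only [φ, Sum.elim_inr, LinearMap.sub_apply, LinearMap.smul_apply, smul_eq_mul]
      exact ((hpd q i).mul_const _).fun_sub ((hpd p i).mul_const _)
  · rintro (⟨p, L, hL⟩ | ⟨i, p, q, K, hK⟩)
    · have hd : DifferentiableOn ℂ (fun y => - ∑ i, leibniz L (s y i) (pderiv p (v i)) y) V :=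
        (DifferentiableOn.fun_sum fun i _ => differentiableOn_leibniz hV (hpd p i) L (hsd i)).fun_neg
      refine hd.congr fun y hy => ?_
      simp only [φ, pr, Sum.elim_inl, LinearMap.sum_apply, LinearMap.smul_apply, smul_eq_mul,
        LinearMap.proj_apply]
      have h2 := (mem_R_iff.1 (hl y hy).1).2.1 p L hL.le
      rw [← zero_sub, ← h2, ← Finset.sum_sub_distrib]
      refine Finset.sum_congr rfl fun i _ => ?_
      rw [← split y hy _ _ _ _ fun J hJ => low y hy i J (by omega), top y hy i L hL]
      ring
    · have hd : DifferentiableOn ℂ (fun y =>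
          leibniz K (fun J => s y i (incr q J)) (pderiv p (v i)) y -
          leibniz K (fun J => s y i (incr p J)) (pderiv q (v i)) y) V :=
        (differentiableOn_leibniz hV (hpd p i) K fun J => hsd i (incr q J)).fun_sub
          (differentiableOn_leibniz hV (hpd q i) K fun J => hsd i (incr p J))
      refine hd.congr fun y hy => ?_
      simp only [φ, pr, Sum.elim_inr, LinearMap.sub_apply, LinearMap.smul_apply, smul_eq_mul,
        LinearMap.proj_apply]
      have h3 := (mem_R_iff.1 (hl y hy).1).2.2 i p q K (by omega)
      have e1 := split y hy (fun J => lift v k y (s y) i (incr p J)) (fun J => s y i (incr p J))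
          (pderiv q (v i)) K fun J hJ => low y hy i _ (by rw [ord_incr]; omega)
      have e2 := split y hy (fun J => lift v k y (s y) i (incr q J)) (fun J => s y i (incr q J))
          (pderiv p (v i)) K fun J hJ => low y hy i _ (by rw [ord_incr]; omega)
      rw [top y hy i _ (hinc p hK)] at e1
      rw [top y hy i _ (hinc q hK)] at e2
      linear_combination e1 - e2 + h3
  · intro y hy c hc
    let z : Jet n d := fun i L => if hL : ord L = k + 1 then c (i, ⟨L, hI.2 hL⟩) else 0
    have hz : ∀ i L (hL : ord L = k + 1), z i L = c (i, ⟨L, hI.2 hL⟩) := fun i L hL => dif_pos hL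
    funext ⟨i, L, hL⟩
    rw [← hz i L (hI.1 hL), Pi.zero_apply]
    refine eq_zero_of_principal_part (g := fun i p => pderiv p (v i) y)
      ((H y hy).exists_pderiv_ne_zero (by omega)) (H y hy).injective (z := z)
      (fun p K hK => ?_) (fun j p q K hK => ?_) i L (hI.1 hL)
    · have := hc (Sum.inl (p, ⟨K, hK⟩))
      simp only [φ, pr, Sum.elim_inl, LinearMap.sum_apply, LinearMap.smul_apply, smul_eq_mul,
        LinearMap.proj_apply] at this
      rw [← this]
      exact Finset.sum_congr rfl fun i _ => by rw [hz i K hK, mul_comm]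
    · have := hc (Sum.inr (j, p, q, ⟨K, hK⟩))
      simp only [φ, pr, Sum.elim_inr, LinearMap.sub_apply, LinearMap.smul_apply, smul_eq_mul,
        LinearMap.proj_apply] at this
      rw [hz _ _ (hinc p hK), hz _ _ (hinc q hK), ← this]
      ring

theorem covDeriv_apply_of_le (p : Fin n) (y : Fin n → ℂ) (i : Fin d) {L : Fin n → ℕ}
    (hL : ord L ≤ k) : covDeriv v k p s y i L =
      pderiv p (fun z => s z i L) y - lift v k y (s y) i (incr p L) :=
  trunc_of_le _ i hL

theorem differentiableOn_covDeriv (hV : IsOpen V) (hv : ∀ i, DifferentiableOn ℂ (v i) V)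
    (H : ∀ y ∈ V, MonomialsInvertible v (k + 2) y) (hs : ∀ y ∈ V, s y ∈ R v k y)
    (hsd : ∀ i L, DifferentiableOn ℂ (fun y => s y i L) V) (p : Fin n) (i : Fin d)
    (L : Fin n → ℕ) : DifferentiableOn ℂ (fun y => covDeriv v k p s y i L) V := by
  by_cases hL : ord L ≤ k
  · simp only [covDeriv_apply_of_le p _ i hL]
    exact (differentiableOn_pderiv hV (hsd i L) p).fun_sub
      (differentiableOn_lift hV hv H hs hsd i _)
  · have : ∀ y, covDeriv v k p s y i L = 0 := fun y => trunc_of_lt _ i (not_le.1 hL)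
    simp only [this]
    exact differentiableOn_const 0

/-- The tautological connection preserves the sections of `R_k`. -/
theorem covDeriv_mem (hV : IsOpen V) (hv : ∀ i, DifferentiableOn ℂ (v i) V)
    (H : ∀ y ∈ V, MonomialsInvertible v (k + 2) y) (hs : ∀ y ∈ V, s y ∈ R v k y)
    (hsd : ∀ i L, DifferentiableOn ℂ (fun y => s y i L) V) (r : Fin n) {y : Fin n → ℂ}
    (hy : y ∈ V) : covDeriv v k r s y ∈ R v k y := by
  have hpd : ∀ p i, DifferentiableOn ℂ (pderiv p (v i)) V := fun p i =>
    differentiableOn_pderiv hV (hv i) p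
  have hl := isLift_lift hV hv hy (H y hy) (hs y hy)
  have h := mem_R_iff.1 hl.1
  have zero : ∀ f : (Fin n → ℂ) → ℂ, (∀ z ∈ V, f z = 0) → pderiv r f y = 0 := fun f hf => by
    rw [pderiv_eqOn (g' := fun _ => 0) hV (fun z hz => hf z hz) r hy]
    simp [pderiv]
  refine mem_R_iff.2 ⟨fun i L hL => trunc_of_lt _ i hL, fun p L hL => ?_, fun i p q L hL => ?_⟩
  -- The first term differentiates an equation valid for `s` throughout `V`; the second is an
  -- equation of the lift at `L + 1_r`, of order at most `k + 1`. Both vanish after summation.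
  · have e : ∀ i, leibniz L (covDeriv v k r s y i) (pderiv p (v i)) y =
        pderiv r (fun z => leibniz L (s z i) (pderiv p (v i)) z) y -
          leibniz (incr r L) (lift v k y (s y) i) (pderiv p (v i)) y := fun i => by
      rw [leibniz_congr fun K hK => covDeriv_apply_of_le r y i (hK.trans hL), leibniz_sub,
        pderiv_leibniz hV (hpd p i) hy r L (hsd i), leibniz_incr hV (hpd p i) hy,
        leibniz_congr (w := lift v k y (s y) i) fun K hK => hl.apply_of_le i (hK.trans hL)]
      ring
    simp only [e, Finset.sum_sub_distrib]
    rw [h.2.1 p (incr r L) (by rw [ord_incr]; omega), sub_zero]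
    refine (pderiv_sum Finset.univ
      (fun i => differentiableOn_leibniz hV (hpd p i) L (hsd i)) hV r hy).symm.trans ?_
    exact zero _ fun z hz => (mem_R_iff.1 (hs z hz)).2.1 p L hL
  · have e : ∀ p q : Fin n, leibniz L (fun K => covDeriv v k r s y i (incr p K)) (pderiv q (v i)) y =
        pderiv r (fun z => leibniz L (fun K => s z i (incr p K)) (pderiv q (v i)) z) y -
          leibniz (incr r L) (fun K => lift v k y (s y) i (incr p K)) (pderiv q (v i)) y :=
      fun p q => by
      rw [leibniz_congr fun K hK => covDeriv_apply_of_le r y i (L := incr p K)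
          (by rw [ord_incr]; omega), leibniz_sub,
        pderiv_leibniz hV (hpd q i) hy r L (fun K => hsd i (incr p K)),
        leibniz_incr hV (hpd q i) hy,
        leibniz_congr (w := fun K => lift v k y (s y) i (incr p K)) fun K hK =>
          hl.apply_of_le i (L := incr p K) (by rw [ord_incr]; omega)]
      simp only [incr_comm p r]
      ring
    rw [e, e]
    have h0 := h.2.2 i p q (incr r L) (by rw [ord_incr]; omega)
    have e3 : pderiv r (fun z => leibniz L (fun K => s z i (incr p K)) (pderiv q (v i)) z) y =
        pderiv r (fun z => leibniz L (fun K => s z i (incr q K)) (pderiv p (v i)) z) y :=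
      pderiv_eqOn hV (fun z hz => sub_eq_zero.1 ((mem_R_iff.1 (hs z hz)).2.2 i p q L hL)) r hy
    linear_combination e3 - h0

variable {N : ℕ} {σ : Fin N → (Fin n → ℂ) → Jet n d}

theorem exists_isConnectionMatrix (hV : IsOpen V) (hv : ∀ i, DifferentiableOn ℂ (v i) V)
    (H : ∀ y ∈ V, MonomialsInvertible v (k + 2) y) (hs : ∀ a, ∀ y ∈ V, σ a y ∈ R v k y)
    (hsd : ∀ a i L, DifferentiableOn ℂ (fun y => σ a y i L) V)
    (hli : ∀ y ∈ V, LinearIndependent ℂ fun a => σ a y)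
    (hsp : ∀ y ∈ V, Submodule.span ℂ (Set.range fun a => σ a y) = R v k y) :
    ∃ θ, IsConnectionMatrix v k V σ θ := by
  classical
  have hex : ∀ p a y, ∃ t : Fin N → ℂ, y ∈ V →
      covDeriv v k p (σ a) y = ∑ b, t b • σ b y := by
    intro p a y
    by_cases hy : y ∈ V
    · have := covDeriv_mem hV hv H (hs a) (hsd a) p hy
      rw [← hsp y hy, Submodule.mem_span_range_iff_exists_fun] at this
      obtain ⟨t, ht⟩ := this
      exact ⟨t, fun _ => ht.symm⟩
    · exact ⟨0, fun h => absurd h hy⟩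
  choose t ht using hex
  refine ⟨fun p y => Matrix.of fun b a => t p a y b, fun p b a => ?_, fun y hy p a => ht p a y hy⟩
  simp only [Matrix.of_apply]
  -- The coefficients were chosen point by point; they are holomorphic because they solve the system
  -- given by all jet coordinates, injective since the frame is independent.
  let φ : Fin d × (Fin n → ℕ) → (Fin n → ℂ) → (Fin N → ℂ) →ₗ[ℂ] ℂ := fun j y =>
    ∑ b, σ b y j.1 j.2 • LinearMap.proj b
  have hφ : ∀ j y c, φ j y c = (∑ b, c b • σ b y) j.1 j.2 := fun j y c => by
    simp [φ, Finset.sum_apply, mul_comm]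
  refine differentiableOn_of_injective_system hV φ (t p a) (fun j c => ?_) (fun j => ?_)
    (fun y hy c hc => ?_) b
  · simp only [φ, LinearMap.sum_apply, LinearMap.smul_apply, smul_eq_mul]
    exact DifferentiableOn.fun_sum fun b _ => (hsd b _ _).mul_const _
  · refine (differentiableOn_covDeriv hV hv H (hs a) (hsd a) p j.1 j.2).congr fun y hy => ?_
    rw [hφ, ht p a y hy]
  · refine funext fun b => Fintype.linearIndependent_iff.1 (hli y hy) c ?_ b
    funext i L
    rw [← hφ (i, L), hc]; rfl

theorem IsConnectionMatrix.unique {θ θ' : Fin n → (Fin n → ℂ) → Matrix (Fin N) (Fin N) ℂ}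
    (hli : ∀ y ∈ V, LinearIndependent ℂ fun a => σ a y) (h : IsConnectionMatrix v k V σ θ)
    (h' : IsConnectionMatrix v k V σ θ') (p : Fin n) : Set.EqOn (θ' p) (θ p) V := by
  intro y hy
  ext b a
  have := (h'.2 y hy p a).symm.trans (h.2 y hy p a)
  rw [← sub_eq_zero, ← Finset.sum_sub_distrib] at this
  simp only [← sub_smul] at this
  exact sub_eq_zero.1 (Fintype.linearIndependent_iff.1 (hli y hy) _ this b)

/-- The curvature takes its values in the jets that vanish up to order `k - 1`. -/
theorem sum_curvature_smul_apply (hV : IsOpen V) (hv : ∀ i, DifferentiableOn ℂ (v i) V)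
    (H : ∀ y ∈ V, MonomialsInvertible v (k + 2) y) (hs : ∀ a, ∀ y ∈ V, σ a y ∈ R v k y)
    (hsd : ∀ a i L, DifferentiableOn ℂ (fun y => σ a y i L) V)
    {θ : Fin n → (Fin n → ℂ) → Matrix (Fin N) (Fin N) ℂ} (hθ : IsConnectionMatrix v k V σ θ)
    {y : Fin n → ℂ} (hy : y ∈ V) (p q : Fin n) (a : Fin N) (i : Fin d) {L : Fin n → ℕ}
    (hL : ord L < k) : ∑ b, curvature θ p q y b a * σ b y i L = 0 := by
  have hl : ∀ a, ∀ z ∈ V, IsLift v k z (σ a z) (lift v k z (σ a z)) := fun a z hz =>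
    isLift_lift hV hv hz (H z hz) (hs a z hz)
  have hcov : ∀ a p K, ord K ≤ k → ∀ z ∈ V, pderiv p (fun z => σ a z i K) z =
      lift v k z (σ a z) i (incr p K) + ∑ b, θ p z b a * σ b z i K := by
    intro a p K hK z hz
    have h1 := congrFun (congrFun (hθ.2 z hz p a) i) K
    rw [covDeriv_apply_of_le p z i hK] at h1
    simp only [Finset.sum_apply, Pi.smul_apply, smul_eq_mul] at h1
    linear_combination h1
  have hlow : ∀ a p, ∀ z ∈ V, pderiv p (fun z => σ a z i L) z =
      σ a z i (incr p L) + ∑ b, θ p z b a * σ b z i L := fun a p z hz => by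
    rw [hcov a p L hL.le z hz, (hl a z hz).apply_of_le i (by rw [ord_incr]; omega)]
  -- The lift term and the sum of the two terms in `incr p L` and `incr q L` are symmetric in `p`
  -- and `q`; antisymmetrizing leaves exactly the curvature.
  have key : ∀ p q : Fin n, pderiv p (pderiv q fun z => σ a z i L) y =
      lift v k y (σ a y) i (incr p (incr q L)) + ∑ b, θ p y b a * σ b y i (incr q L) +
        (∑ b, pderiv p (fun z => θ q z b a) y * σ b y i L +
          (∑ b, θ q y b a * σ b y i (incr p L) + ∑ b, (θ p y * θ q y) b a * σ b y i L)) := by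
    intro p q
    rw [pderiv_eqOn hV (hlow a q) p hy, pderiv_add (hsd a i _)
      (DifferentiableOn.fun_sum fun b _ => (hθ.1 q b a).fun_mul (hsd b i L)) hV p hy]
    simp only
    rw [hcov a p _ (by rw [ord_incr]; omega) y hy,
      pderiv_sum Finset.univ (fun b => (hθ.1 q b a).fun_mul (hsd b i L)) hV p hy]
    congr 1
    have e : ∀ b, pderiv p (fun z => θ q z b a * σ b z i L) y =
        pderiv p (fun z => θ q z b a) y * σ b y i L + (θ q y b a * σ b y i (incr p L) +
          ∑ c, θ q y b a * (θ p y c b * σ c y i L)) := fun b => by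
      rw [pderiv_mul (hθ.1 q b a) (hsd b i L) hV p hy]
      simp only
      rw [hlow b p y hy, mul_add, Finset.mul_sum]
    simp only [e, Finset.sum_add_distrib]
    congr 2
    rw [Finset.sum_comm]
    refine Finset.sum_congr rfl fun c _ => ?_
    rw [Matrix.mul_apply, Finset.sum_mul]
    exact Finset.sum_congr rfl fun b _ => by ring
  have hc := pderiv_comm hV (hsd a i L) p q hy
  rw [key, key, incr_comm p q] at hc
  simp only [curvature, Matrix.add_apply, Matrix.sub_apply, Matrix.of_apply, add_mul, sub_mul,
    Finset.sum_add_distrib, Finset.sum_sub_distrib]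
  linear_combination hc

end Connection

/-! ### Counting monomials, calibration and adapted frames -/

section OrdinaryWebs

theorem c_eq_choose (n h : ℕ) : c n h = (n - 1 + h).choose h := by
  rw [c, Nat.add_choose]

theorem card_piAntidiag_eq_c {n : ℕ} (hn : n ≠ 0) (h : ℕ) :
    (Finset.piAntidiag (Finset.univ : Finset (Fin n)) h).card = c n h := by
  rw [← Finset.map_sym_eq_piAntidiag, Finset.card_map, Finset.sym_univ, Finset.card_univ,
    Sym.card_sym_eq_choose, Fintype.card_fin, c_eq_choose]
  congr 1
  omega

/-- Pascal's rule for the number of monomials. -/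
theorem c_sub_c {n : ℕ} (hn : 2 ≤ n) (h : ℕ) :
    c n (h + 1) - c n h = (n - 2 + (h + 1)).factorial / ((n - 2).factorial * (h + 1).factorial) := by
  obtain ⟨m, rfl⟩ : ∃ m, n = m + 2 := ⟨n - 2, by omega⟩
  rw [c_eq_choose, c_eq_choose, ← Nat.add_choose]
  have : (m + 2 - 1 + (h + 1)).choose (h + 1) =
      (m + 2 - 1 + h).choose h + (m + 2 - 2 + (h + 1)).choose (h + 1) := by
    rw [show m + 2 - 1 + (h + 1) = (m + 1 + h) + 1 by omega, Nat.choose_succ_succ,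
      show m + 2 - 1 + h = m + 1 + h by omega, show m + 2 - 2 + (h + 1) = m + 1 + h by omega]
  omega

theorem partialRank_succ (n d h : ℕ) :
    partialRank n d (h + 1) = partialRank n d h + (d - c n (h + 1)) := by
  rw [partialRank, partialRank, Finset.sum_Icc_succ_top (by omega)]

variable {n d : ℕ} {M : Type*} [TopologicalSpace M] [ChartedSpace (Fin n → ℂ) M]
  {W : Web n d M} {U : Set M}

theorem LocalData.isOpen_region (D : LocalData W) (hU : IsOpen U) : IsOpen (D.region U) :=
  D.chart.isOpen_inter_preimage_symm hU

theorem LocalData.differentiableOn_v [IsManifold 𝓘(ℂ, Fin n → ℂ) ω M] (D : LocalData W)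
    (i : Fin d) : DifferentiableOn ℂ (D.v i) D.chart.target := by
  rw [← mdifferentiableOn_iff_differentiableOn]
  exact (D.isFirstIntegrals.holomorphic i).comp
    ((contMDiffOn_symm_of_mem_maximalAtlas D.chart_mem).mdifferentiableOn (by simp))
    D.chart.mapsTo_symm

/-- On a calibrated ordinary web, the square matrix of the monomials of degree `k₀` is
invertible. -/
theorem LocalData.monomialsInvertible (hn : n ≠ 0) (D : LocalData W) {k₀ : ℕ} (hk₀ : 1 ≤ k₀)
    (hd : d = c n k₀) (hW : ∀ m ∈ U, W.OrdinaryAt m) {y : Fin n → ℂ} (hy : y ∈ D.region U) :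
    MonomialsInvertible D.v k₀ y := by
  have hrank := hW _ hy.2 D (D.chart.map_target hy.1) k₀ hk₀
  rw [D.chart.right_inv hy.1, ← hd, min_self, ← Matrix.rank_transpose] at hrank
  let P := D.monomialMatrix k₀ y
  have hcard : Module.finrank ℂ ({L : Fin n → ℕ // L ∈ Finset.piAntidiag Finset.univ k₀} → ℂ) =
      d := by
    rw [Module.finrank_pi, Fintype.card_coe, card_piAntidiag_eq_c hn, ← hd]
  -- Calibration makes the matrix square, so its maximal rank `d` gives both surjectivity and
  -- injectivity. The transpose is the one acting on the coefficients `a i`.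
  have hsurj : Function.Surjective P.transpose.mulVecLin := by
    rw [← LinearMap.range_eq_top]
    exact Submodule.eq_top_of_finrank_eq (hrank.trans hcard.symm)
  have hinj : Function.Injective P.transpose.mulVecLin :=
    (LinearMap.injective_iff_surjective_of_finrank_eq_finrank
      (by rw [hcard, Module.finrank_pi, Fintype.card_fin])).2 hsurj
  have happ : ∀ (a : Fin d → ℂ) L, P.transpose.mulVecLin a L =
      ∑ i, a i * ∏ p, pderiv p (D.v i) y ^ L.1 p := fun a L => by
    simp only [Matrix.mulVecLin_apply, Matrix.mulVec, dotProduct, Matrix.transpose_apply, P,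
      LocalData.monomialMatrix, Matrix.of_apply, mul_comm]
  refine ⟨fun a ha => hinj ?_, fun b => ?_⟩
  · rw [map_zero]
    funext L
    rw [happ]
    exact ha L.1 (Finset.mem_piAntidiag.1 L.2).1
  · obtain ⟨a, ha⟩ := hsurj fun L => b L.1
    refine ⟨a, fun L hL => ?_⟩
    have := congrFun ha ⟨L, Finset.mem_piAntidiag.2 ⟨hL, by simp⟩⟩
    rwa [happ] at this

/-- The last step of the filtration is spanned by the last sections of an adapted trivialization. -/
theorem coeff_eq_zero_of_mem_filt {k₀ N : ℕ} (hk₀ : 3 ≤ k₀)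
    {σ : Fin N → LocalData W → (Fin n → ℂ) → Jet n d} (hσa : IsAdapted k₀ U σ) (D : LocalData W)
    {y : Fin n → ℂ} (hy : y ∈ D.region U) (hli : LinearIndependent ℂ fun a => σ a D y)
    {t : Fin N → ℂ} (ht : ∑ b, t b • σ b D y ∈ filt D.v (k₀ - 2) (k₀ - 2) y) {b : Fin N}
    (hb : (b : ℕ) < partialRank n d (k₀ - 2)) : t b = 0 := by
  have h := (hσa D y hy (k₀ - 2) (by omega) le_rfl).1
  -- A jet of order `k₀ - 2` vanishing up to that order is zero, so the complement supplied by
  -- adaptedness at `h = k₀ - 2` is all of `F_{k₀-2}`.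
  have hbot : filt D.v (k₀ - 2) (k₀ - 2 + 1) y = ⊥ := by
    refine (Submodule.eq_bot_iff _).2 fun x hx => ?_
    funext i L
    rcases Nat.lt_or_ge (k₀ - 2) (ord L) with hL | hL
    · exact (mem_R_iff.1 hx.1).1 i L hL
    · exact hx.2 i L (by omega)
  rw [hbot, sup_bot_eq] at h
  rw [← h, Finsupp.mem_span_image_iff_linearCombination] at ht
  obtain ⟨l, hl, hlt⟩ := ht
  have heq : ∑ b, (t b - l b) • σ b D y = 0 := by
    simp only [sub_smul, Finset.sum_sub_distrib, ← hlt]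
    rw [Finsupp.linearCombination_apply, Finsupp.sum_fintype _ _ (by simp), sub_self]
  have := Fintype.linearIndependent_iff.1 hli _ heq b
  rw [sub_eq_zero] at this
  rw [this]
  by_contra h0
  have := (Finsupp.mem_supported _ _).1 hl (Finsupp.mem_support_iff.2 h0)
  exact absurd this.1 (by omega)

end OrdinaryWebs

end OrdinaryWeb

end

/-! ### The main theorem -/

theorem mainTheorem1 {n d k₀ : ℕ} (hn : 2 ≤ n) (hk₀ : 2 ≤ k₀) (hd : d = OrdinaryWeb.c n k₀)
    {M : Type*} [TopologicalSpace M] [ChartedSpace (Fin n → ℂ) M]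
    [IsManifold 𝓘(ℂ, Fin n → ℂ) ω M]
    (W : OrdinaryWeb.Web n d M) (U : Set M) (hU : IsOpen U) (hW : ∀ m ∈ U, W.OrdinaryAt m)
    (σ : Fin (OrdinaryWeb.partialRank n d (k₀ - 1)) →
      OrdinaryWeb.LocalData W → (Fin n → ℂ) → OrdinaryWeb.Jet n d)
    (hσ : W.IsTrivialization (k₀ - 2) U σ) (hσa : OrdinaryWeb.IsAdapted k₀ U σ)
    (D : OrdinaryWeb.LocalData W) :
    -- the tautological connection is well defined
    (∀ y ∈ D.region U, ∀ x ∈ OrdinaryWeb.R D.v (k₀ - 2) y,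
      ∃! x', OrdinaryWeb.IsLift D.v (k₀ - 2) y x x') ∧
    -- its matrix relative to the trivialization exists and is unique, and the curvature matrix is
    -- concentrated in the last rows
    ∃ θ, OrdinaryWeb.IsConnectionMatrix D.v (k₀ - 2) (D.region U) (fun a => σ a D) θ ∧
      (∀ θ', OrdinaryWeb.IsConnectionMatrix D.v (k₀ - 2) (D.region U) (fun a => σ a D) θ' →
        ∀ p, Set.EqOn (θ' p) (θ p) (D.region U)) ∧
      ∀ y ∈ D.region U, ∀ (p q : Fin n) (a b : Fin (OrdinaryWeb.partialRank n d (k₀ - 1))),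
        ((b : ℕ) + (n - 2 + k₀).factorial / ((n - 2).factorial * k₀.factorial)
            < OrdinaryWeb.partialRank n d (k₀ - 1) →
          OrdinaryWeb.curvature θ p q y b a = 0) ∧
        (n = 2 → (b : ℕ) + 1 < OrdinaryWeb.partialRank n d (k₀ - 1) →
          OrdinaryWeb.curvature θ p q y b a = 0) := by
  obtain ⟨k, rfl⟩ : ∃ k, k₀ = k + 2 := ⟨k₀ - 2, by omega⟩
  have hV := D.isOpen_region hU
  have hv : ∀ i, DifferentiableOn ℂ (D.v i) (D.region U) := fun i =>
    (D.differentiableOn_v i).mono Set.inter_subset_left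
  have H : ∀ y ∈ D.region U, OrdinaryWeb.MonomialsInvertible D.v (k + 2) y := fun y hy =>
    D.monomialsInvertible (by omega) (by omega) hd hW hy
  have hs : ∀ a, ∀ y ∈ D.region U, σ a D y ∈ OrdinaryWeb.R D.v k y := fun a =>
    (hσ.isSection a).mem D
  have hsd : ∀ a i L, DifferentiableOn ℂ (fun y => σ a D y i L) (D.region U) := fun a =>
    (hσ.isSection a).holomorphic D
  have hli := hσ.linearIndependent D
  refine ⟨fun y hy x hx => OrdinaryWeb.existsUnique_isLift hV hv hy (H y hy) hx, ?_⟩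
  obtain ⟨θ, hθ⟩ := OrdinaryWeb.exists_isConnectionMatrix hV hv H hs hsd hli (hσ.span_eq D)
  have hlast : d - OrdinaryWeb.c n (k + 1) =
      (n - 2 + (k + 2)).factorial / ((n - 2).factorial * (k + 2).factorial) := by
    rw [hd, OrdinaryWeb.c_sub_c hn (k + 1)]
  have hrank : OrdinaryWeb.partialRank n d (k + 2 - 1) =
      OrdinaryWeb.partialRank n d k + (d - OrdinaryWeb.c n (k + 1)) :=
    OrdinaryWeb.partialRank_succ n d k
  have main : ∀ y ∈ D.region U, ∀ (p q : Fin n)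
      (a b : Fin (OrdinaryWeb.partialRank n d (k + 2 - 1))),
      (b : ℕ) < OrdinaryWeb.partialRank n d k → OrdinaryWeb.curvature θ p q y b a = 0 := by
    intro y hy p q a b hb
    -- For `k = 0` adaptedness is an empty condition, but `partialRank n d 0 = 0` and there are no
    -- preceding rows.
    have hk : 1 ≤ k := by
      rcases Nat.eq_zero_or_pos k with rfl | h
      · simp [OrdinaryWeb.partialRank] at hb
      · exact h
    refine OrdinaryWeb.coeff_eq_zero_of_mem_filt (k₀ := k + 2) (by omega) hσa D hy (hli y hy)
      (t := fun b => OrdinaryWeb.curvature θ p q y b a) ⟨Submodule.sum_mem _ fun b _ =>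
        Submodule.smul_mem _ _ (hs b y hy), fun i L hL => ?_⟩ hb
    simpa using OrdinaryWeb.sum_curvature_smul_apply hV hv H hs hsd hθ hy p q a i hL
  refine ⟨θ, hθ, fun θ' hθ' p => hθ.unique hli hθ' p, fun y hy p q a b => ⟨fun hb => ?_,
    fun hn2 hb => ?_⟩⟩
  · exact main y hy p q a b (by omega)
  -- For `n = 2` the quotient is `k₀! / (0! k₀!)`, so the last block is a single row.
  · have h1 : (n - 2 + (k + 2)).factorial / ((n - 2).factorial * (k + 2).factorial) = 1 := by
      subst hn2
      simp [Nat.div_self (Nat.factorial_pos _)]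
    exact main y hy p q a b (by omega)
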